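/- Let $k$ be a field and let $R=\bigoplus_{(u,v)\in\mathbb N^2}R_{(u,v)}$ be a commutative bigraded $k$-algebra generated over $k$ by finitely many elements $x_1,\dots,x_n$ of bidegree $(1,0)$ and $y_1,\dots,y_r$ of bidegrees $(d_1,1),\dots,(d_r,1)$, where $d_1,\dots,d_r$ are non-negative integers, and set $d=\max\{d_1,\dots,d_r\}$ ($d=0$ if $r=0$). Then there is a unique polynomial $P_R(u,v)\in\mathbb Q[u,v]$ (the Hilbert polynomial of $R$) for which there exist integers $u_0,v_0$ with $\dim_k R_{(u,v)}=P_R(u,v)$ for all $u\ge dv+u_0$, $v\ge v_0$. Let $R_v=\bigoplus_{u\ge 0}R_{(u,v)}$, regarded as a module over the ring $R_0=\bigoplus_{u\ge0}R_{(u,0)}$. Let $R_{++}$ be the ideal of $R$ generated by the products $x_iy_j$, let $0:(R_{++})^\infty$ be the ideal of the elements of $R$ annihilated by some power of $R_{++}$, let $\bar R=R/\bigl(0:(R_{++})^\infty\bigr)$ with the induced bigrading, and let $x\text{-}\dim R=\dim \bar R_0$ be the Krull dimension of the ring $\bar R_0=\bigoplus_{u\ge0}\bar R_{(u,0)}$.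 Then all these dimensions are finite for $v$ large, and, for all sufficiently large $v$, $$\deg_u P_R(u,v)=\dim R_v-1=x\text{-}\dim R-1 ,$$ where $\deg_u$ denotes the degree in the variable $u$ and $\dim R_v$ is the Krull dimension of the $R_0$-module $R_v$. Here the zero polynomial has degree $-1$, and the zero ring and the zero module have dimension $0$. -/

import Mathlib

namespace BigradedHilbert

section Rows

variable {k R : Type*} [Field k] [CommRing R] [Algebra k R]

/-- The row `R_v = ⊕_u R_(u,v)` of a family of subspaces indexed by `ℕ × ℕ`, as a `k`-subspace
(the sum is direct as soon as the family is a grading). -/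
def row (𝒜 : ℕ × ℕ → Submodule k R) (v : ℕ) : Submodule k R :=
  ⨆ u : ℕ, 𝒜 (u, v)

theorem row_mul_row_le (𝒜 : ℕ × ℕ → Submodule k R) [SetLike.GradedMonoid 𝒜] (v w : ℕ) :
    row 𝒜 v * row 𝒜 w ≤ row 𝒜 (v + w) := by
  unfold row
  rw [Submodule.iSup_mul]
  refine iSup_le fun u => ?_
  rw [Submodule.mul_iSup]
  refine iSup_le fun u' => ?_
  refine le_trans (Submodule.mul_le.2 fun a ha b hb => ?_) (le_iSup _ (u + u'))
  exact SetLike.GradedMul.mul_mem ha hb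

theorem mul_mem_row (𝒜 : ℕ × ℕ → Submodule k R) [SetLike.GradedMonoid 𝒜] {v w : ℕ} {a b : R}
    (ha : a ∈ row 𝒜 v) (hb : b ∈ row 𝒜 w) : a * b ∈ row 𝒜 (v + w) :=
  row_mul_row_le 𝒜 v w (Submodule.mul_mem_mul ha hb)

theorem one_mem_row (𝒜 : ℕ × ℕ → Submodule k R) [SetLike.GradedMonoid 𝒜] :
    (1 : R) ∈ row 𝒜 0 :=
  (le_iSup (fun u : ℕ => 𝒜 (u, 0)) 0) SetLike.GradedOne.one_mem

/-- The `k`-subalgebra `R_0 = ⊕_u R_(u,0)` of `R`. -/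
def rowZero (𝒜 : ℕ × ℕ → Submodule k R) [SetLike.GradedMonoid 𝒜] : Subalgebra k R :=
  (row 𝒜 0).toSubalgebra (one_mem_row 𝒜) fun a b ha hb => by
    have h : a * b ∈ row 𝒜 (0 + 0) := mul_mem_row 𝒜 ha hb
    rw [add_zero] at h
    exact h

/-- `R_v` as a module over `R_0` (a submodule of `R` viewed as an `R_0`-module). -/
def rowModule (𝒜 : ℕ × ℕ → Submodule k R) [SetLike.GradedMonoid 𝒜] (v : ℕ) :
    Submodule (rowZero 𝒜) R where
  carrier := row 𝒜 v
  add_mem' := fun ha hb => (row 𝒜 v).add_mem ha hb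
  zero_mem' := (row 𝒜 v).zero_mem
  smul_mem' := fun c b hb => by
    have h : (c : R) * b ∈ row 𝒜 (0 + v) := mul_mem_row 𝒜 c.2 hb
    rw [zero_add] at h
    exact h

/-- The bigrading on a quotient `R ⧸ J`: its pieces are the images of those of `R`. -/
def quotGrading (𝒜 : ℕ × ℕ → Submodule k R) (J : Ideal R) :
    ℕ × ℕ → Submodule k (R ⧸ J) :=
  fun i => (𝒜 i).map (Ideal.Quotient.mkₐ k J).toLinearMap

instance quotGrading_gradedMonoid (𝒜 : ℕ × ℕ → Submodule k R) [SetLike.GradedMonoid 𝒜]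
    (J : Ideal R) : SetLike.GradedMonoid (quotGrading 𝒜 J) where
  one_mem := ⟨1, SetLike.GradedOne.one_mem, map_one (Ideal.Quotient.mkₐ k J)⟩
  mul_mem := by
    rintro i j _ _ ⟨a, ha, rfl⟩ ⟨b, hb, rfl⟩
    exact ⟨a * b, SetLike.GradedMul.mul_mem ha hb, map_mul (Ideal.Quotient.mkₐ k J) a b⟩

end Rows

/-- `0 : I^∞`, the ideal of the elements annihilated by some power of `I`. -/
def zeroColonInfty {R : Type*} [CommRing R] (I : Ideal R) : Ideal R where
  carrier := {a | ∃ m : ℕ, ∀ b ∈ I ^ m, b * a = 0}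
  zero_mem' := ⟨0, fun b _ => mul_zero b⟩
  add_mem' := by
    rintro a a' ⟨m, hm⟩ ⟨m', hm'⟩
    refine ⟨max m m', fun b hb => ?_⟩
    rw [mul_add, hm b (Ideal.pow_le_pow_right (le_max_left _ _) hb),
      hm' b (Ideal.pow_le_pow_right (le_max_right _ _) hb), add_zero]
  smul_mem' := by
    rintro c a ⟨m, hm⟩
    refine ⟨m, fun b hb => ?_⟩
    rw [smul_eq_mul, mul_left_comm, hm b hb, mul_zero]

/-- The ideal `R_{++}` generated by the products `x_i y_j`. -/
def irrelevantIdeal {R : Type*} [CommRing R] {n r : ℕ} (x : Fin n → R) (y : Fin r → R) :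
    Ideal R :=
  Ideal.span (Set.range fun p : Fin n × Fin r => x p.1 * y p.2)

/-- The Krull dimension of a ring, with the convention that the zero ring has dimension `0`. -/
noncomputable def ringDim (A : Type*) [CommRing A] : ℕ∞ :=
  (ringKrullDim A).unbotD 0

/-- The Krull dimension of a module (the dimension of its support), with the convention that the
zero module has dimension `0`. -/
noncomputable def moduleDim (A M : Type*) [CommRing A] [AddCommGroup M] [Module A M] : ℕ∞ :=
  (Module.supportDim A M).unbotD 0

/-- `x-dim R = dim (R̄)_0`, where `R̄ = R ⧸ (0 : (R_{++})^∞)` with the induced bigrading. -/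
noncomputable def xDim {k R : Type*} [Field k] [CommRing R] [Algebra k R]
    (𝒜 : ℕ × ℕ → Submodule k R) [SetLike.GradedMonoid 𝒜]
    {n r : ℕ} (x : Fin n → R) (y : Fin r → R) : ℕ∞ :=
  ringDim (rowZero (quotGrading 𝒜 (zeroColonInfty (irrelevantIdeal x y))))

/-- The Hilbert function `H_R(u,v) = dim_k R_(u,v)`. -/
noncomputable def hilbertFunction {k R : Type*} [Field k] [CommRing R] [Algebra k R]
    (𝒜 : ℕ × ℕ → Submodule k R) (u v : ℕ) : ℕ :=
  Module.finrank k (𝒜 (u, v))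

/-- `P` is a Hilbert polynomial of `R`, where `d` is the maximum of the `d_j`: there are `u₀, v₀`
with `H_R(u,v) = P(u,v)` whenever `u ≥ dv + u₀` and `v ≥ v₀`. The variables `0` and `1` of `P`
stand for `u` and `v`. -/
def IsHilbertPolynomial {k R : Type*} [Field k] [CommRing R] [Algebra k R]
    (𝒜 : ℕ × ℕ → Submodule k R) (d : ℕ) (P : MvPolynomial (Fin 2) ℚ) : Prop :=
  ∃ u₀ v₀ : ℕ, ∀ u v : ℕ, d * v + u₀ ≤ u → v₀ ≤ v →
    (hilbertFunction 𝒜 u v : ℚ) = MvPolynomial.eval ![(u : ℚ), (v : ℚ)] P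

open Classical in
/-- The degree of `P(u,v)` in the variable `u`, with the convention that the zero polynomial has
degree `-1`. -/
noncomputable def degU (P : MvPolynomial (Fin 2) ℚ) : ℤ :=
  if P = 0 then -1 else (MvPolynomial.degreeOf 0 P : ℤ)

end BigradedHilbert

/-! Existence of the Hilbert polynomial is proved for all quotients `R/I` by homogeneous ideals, by
Noetherian induction on `I` (`exists_hilbertPolynomial_quot`). If `I` contains all `x_i` or all
`y_j`, the Hilbert function vanishes on the region. Otherwise take `x_i, y_j ∉ I`. If one of them,
`z`, is a zero divisor modulo `I`, then `I : z` and `I + (z)` are both larger than `I`, and the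
sequence `0 → R/(I : z) → R/I → R/(I + (z)) → 0` (`hilbertFunction_quot_add`) reduces to them. If
both are nonzerodivisors, the differences of the Hilbert function in the directions `(1,0)` and
`(d_j,1)` are Hilbert functions of smaller quotients, hence polynomial, and the function is
recovered by summation (`exists_polynomial_of_differences`).

For the degree, fix `v` and let `I_v` be the annihilator of `R_v` in `R_0`. Since `R_v` is generated
over `R_0` by the finitely many `y^b` with `|b| = v`, the ring `R_0/I_v` embeds in a finite power of
`R_v`, and `R_v` is a finite sum of images of `R_0/I_v`; so their natural filtrations grow at the
same rate. By Noether normalization the growth exponent of `R_0/I_v` is its Krull dimension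
(`exists_growth_bounds`). The growth exponent of the row is the degree of the sums of `P(·,v)`, one
more than the degree of `P(·,v)` (`degree_of_sum_growth`), and for large `v` that degree is `deg_u
P` (`eventually_natDegree_slice`).

Finally let `K = (0 : R_{++}^∞) ∩ R_0`. For large `v`, `I_v ⊆ K`, and `K` is contained in `I_v`
after multiplication by a power of any `x_i`. Hence the two quotients can differ only at primes
containing all `x_i`; these have residue ring `k`, so no positive dimension is lost
(`ringDim_quotient_eq`). -/

open Filter

namespace BigradedHilbert

/-! ### Polynomials in one variable: summation and growth. -/

section Univariate

open Polynomial

/-- A polynomial over `ℚ` is a forward difference. -/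
theorem exists_forwardDifference_eq (q : ℚ[X]) :
    ∃ p : ℚ[X], ∀ t : ℚ, p.eval (t + 1) - p.eval t = q.eval t := by
  induction q using Polynomial.induction_on' with
  | add a b ha hb =>
    obtain ⟨p, hp⟩ := ha
    obtain ⟨p', hp'⟩ := hb
    refine ⟨p + p', fun t => ?_⟩
    rw [eval_add, eval_add, eval_add, ← hp t, ← hp' t]
    ring
  | monomial n a =>
    -- Bernoulli polynomials satisfy `B_{n+1}(t+1) - B_{n+1}(t) = (n+1) t^n`.
    refine ⟨C (a / (n + 1)) * Polynomial.bernoulli (n + 1), fun t => ?_⟩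
    have h := bernoulli_eval_one_add (n + 1) t
    rw [add_comm t 1, eval_mul, eval_mul, eval_C, h, eval_monomial]
    have : (n : ℚ) + 1 ≠ 0 := by positivity
    push_cast
    simp only [eval_C]
    field_simp
    ring

/-- If the degree of `q` were smaller, `q = o(p)` would give `q ≤ p/2 < p` at large integers where
`p` does not vanish. -/
theorem natDegree_le_of_eventually_le {p q : ℚ[X]}
    (h : ∀ᶠ u : ℕ in atTop, 0 ≤ p.eval (u : ℚ) ∧ p.eval (u : ℚ) ≤ q.eval (u : ℚ)) :
    p.natDegree ≤ q.natDegree := by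
  by_contra! hlt
  have hp : p ≠ 0 := by rintro rfl; simp at hlt
  have hdeg : q.degree < p.degree := degree_lt_degree hlt
  have h1 := ((isLittleO_atTop_of_degree_lt _ _ hdeg).comp_tendsto
    (tendsto_natCast_atTop_atTop (R := ℚ))).def (c := 1 / 2) (by norm_num)
  have h2 := (tendsto_natCast_atTop_atTop (R := ℚ)).eventually
    (eventually_atTop_not_isRoot p hp)
  obtain ⟨u, ⟨ha, hb⟩, hc, hd⟩ := (h.and (h1.and h2)).exists
  simp only [Function.comp_apply] at hc
  have hc' : |q.eval (u : ℚ)| ≤ 1 / 2 * |p.eval (u : ℚ)| := by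
    have := hc
    simp only [← Rat.norm_cast_real, Real.norm_eq_abs] at this
    have h3 : ((|q.eval (u : ℚ)| : ℚ) : ℝ) ≤ ((1 / 2 * |p.eval (u : ℚ)| : ℚ) : ℝ) := by
      push_cast
      exact this
    exact_mod_cast h3
  rw [abs_of_nonneg ha, abs_of_nonneg (ha.trans hb)] at hc'
  have h0 : p.eval (u : ℚ) ≠ 0 := hd
  have : 0 < p.eval (u : ℚ) := lt_of_le_of_ne ha h0.symm
  linarith

/-- The degree of a polynomial with given nonzero forward difference. -/
theorem natDegree_of_forwardDifference {g p : ℚ[X]} (hp : p ≠ 0)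
    (h : taylor 1 g - g = p) : g.natDegree = p.natDegree + 1 := by
  obtain ⟨m, hm⟩ : ∃ m, g.natDegree = m + 1 := by
    refine Nat.exists_eq_succ_of_ne_zero fun h0 => hp ?_
    rw [eq_C_of_natDegree_eq_zero h0, taylor_C, sub_self] at h
    exact h.symm
  have hg : g ≠ 0 := by rintro rfl; simp at hm
  -- The `m`-th coefficient of `g(t+1)` is the `m`-th Hasse derivative of `g` at `1`. That
  -- derivative is linear, with value `g_m + (m+1) g_{m+1}`.
  have hcoeff : p.coeff m = (m + 1) * g.leadingCoeff := by
    have hdeg : (hasseDeriv m g).natDegree < 2 := by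
      have := natDegree_hasseDeriv_le g m
      omega
    rw [← h, coeff_sub, taylor_coeff, eval_eq_sum_range' hdeg, Finset.sum_range_succ,
      Finset.sum_range_one, hasseDeriv_coeff, hasseDeriv_coeff, leadingCoeff, hm,
      add_comm 1 m]
    simp
  have hle : p.natDegree ≤ m := by
    refine Nat.le_of_lt_succ (lt_of_le_of_ne ?_ fun hd => ?_)
    · rw [← h, Nat.succ_eq_add_one, ← hm]
      exact (natDegree_sub_le _ _).trans (by simp)
    · have : p.coeff (m + 1) = 0 := by
        rw [← h, coeff_sub, ← hm, coeff_taylor_natDegree, leadingCoeff, sub_self]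
      rw [Nat.succ_eq_add_one] at hd
      rw [← hd, coeff_natDegree, leadingCoeff_eq_zero] at this
      exact hp this
  have hge : m ≤ p.natDegree := by
    refine le_natDegree_of_ne_zero ?_
    rw [hcoeff]
    exact mul_ne_zero (by positivity) (leadingCoeff_ne_zero.2 hg)
  omega

/-- The degree of a polynomial counting function is determined by the growth of its sums. -/
theorem degree_of_sum_growth {h : ℕ → ℕ} {p : ℚ[X]} {i₀ s N c c' N₂ c₂ c₂' : ℕ}
    (hp : ∀ i, i₀ ≤ i → (h i : ℚ) = p.eval (i : ℚ))
    (hlow : ∀ u, (u + 1) ^ s ≤ N * ∑ i ∈ Finset.range (c * u + c'), h i)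
    (hupp : ∀ u, ∑ i ∈ Finset.range u, h i ≤ N₂ * (c₂ * u + c₂') ^ s) :
    if p = 0 then s = 0 else s = p.natDegree + 1 := by
  obtain ⟨g₀, hg₀⟩ := exists_forwardDifference_eq p
  -- With `c = 0` the lower bound compares `(u+1)^s` with a constant, which forces `s = 0`.
  have hc : 0 < c ∨ s = 0 := by
    by_contra! hcon
    obtain ⟨hc, hs⟩ := hcon
    obtain rfl : c = 0 := by omega
    simp only [zero_mul, zero_add] at hlow
    have h1 := hlow (N * ∑ i ∈ Finset.range c', h i)
    have h2 := Nat.le_self_pow hs (N * ∑ i ∈ Finset.range c', h i + 1)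
    omega
  -- The summation constant that makes `g₀ + a` agree with the partial sums of `h` from `i₀` on.
  set a : ℚ := (∑ i ∈ Finset.range i₀, h i : ℕ) - g₀.eval (i₀ : ℚ) with ha
  set g : ℚ[X] := g₀ + C a with hgdef
  have hgp : taylor 1 g - g = p := by
    refine Polynomial.funext fun t => ?_
    rw [eval_sub, taylor_eval, ← hg₀ t, hgdef]
    simp
  have hsum : ∀ u, i₀ ≤ u → ((∑ i ∈ Finset.range u, h i : ℕ) : ℚ) = g.eval (u : ℚ) := by
    intro u hu
    induction u, hu using Nat.le_induction with
    | base => rw [hgdef, eval_add, eval_C, ha]; ring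
    | succ u hu ih =>
      rw [Finset.sum_range_succ, Nat.cast_add, ih, hp u hu, ← hg₀ (u : ℚ), hgdef]
      simp only [eval_add, eval_C, Nat.cast_succ]
      ring
  have hs₁ : g.natDegree ≤ s := by
    refine (natDegree_le_of_eventually_le (q := C (N₂ : ℚ) * (C (c₂ : ℚ) * X + C (c₂' : ℚ)) ^ s)
      ?_).trans ?_
    · filter_upwards [eventually_ge_atTop i₀] with u hu
      rw [← hsum u hu]
      refine ⟨by positivity, ?_⟩
      have := hupp u
      simp only [eval_mul, eval_C, eval_pow, eval_add, eval_X]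
      exact_mod_cast this
    · refine (natDegree_C_mul_le _ _).trans (natDegree_pow_le.trans ?_)
      calc s * _ ≤ s * 1 := Nat.mul_le_mul_left _ natDegree_linear_le
        _ = s := mul_one s
  have hs₂ : s ≤ g.natDegree := by
    rcases hc with hc | hc
    swap
    · omega
    have h1 : ((X + C 1 : ℚ[X]) ^ s).natDegree ≤
        (C (N : ℚ) * g.comp (C (c : ℚ) * X + C (c' : ℚ))).natDegree := by
      refine natDegree_le_of_eventually_le ?_
      filter_upwards [eventually_ge_atTop i₀] with u hu
      have hu' : i₀ ≤ c * u + c' := by nlinarith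
      have h2 := hlow u
      have h3 := hsum _ hu'
      simp only [eval_mul, eval_C, eval_pow, eval_add, eval_X, eval_comp]
      refine ⟨by positivity, ?_⟩
      push_cast at h3
      rw [← h3]
      exact_mod_cast h2
    rw [natDegree_pow, natDegree_X_add_C, mul_one] at h1
    refine h1.trans ((natDegree_C_mul_le _ _).trans (natDegree_comp_le.trans ?_))
    calc g.natDegree * _ ≤ g.natDegree * 1 := Nat.mul_le_mul_left _ natDegree_linear_le
      _ = g.natDegree := mul_one _
  have hs : s = g.natDegree := le_antisymm hs₂ hs₁
  split_ifs with hp0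
  · rw [hp0, sub_eq_zero] at hgp
    by_contra hs0
    have hconst : ∀ u : ℕ, g.eval (u : ℚ) = g.eval 0 := by
      intro u
      induction u with
      | zero => simp
      | succ u ih => rw [← ih, Nat.cast_succ, ← taylor_eval, hgp]
    have hgC : g = C (g.eval 0) := by
      refine eq_of_infinite_eval_eq _ _ (Set.Infinite.mono ?_
        (Set.infinite_range_of_injective (Nat.cast_injective (R := ℚ))))
      rintro _ ⟨u, rfl⟩
      simp [hconst u]
    rw [hgC] at hs
    simp at hs
    exact hs0 hs
  · rw [hs, natDegree_of_forwardDifference hp0 hgp]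

end Univariate

/-! ### Polynomials in two variables: slices and summation. -/

section Bivariate

open MvPolynomial

/-- The polynomial `P(u, t)` in the variable `u`. -/
noncomputable def slice (P : MvPolynomial (Fin 2) ℚ) (t : ℚ) : Polynomial ℚ :=
  (finSuccEquiv ℚ 1 P).map (eval ![t])

theorem eval_slice (P : MvPolynomial (Fin 2) ℚ) (u t : ℚ) :
    (slice P t).eval u = eval ![u, t] P :=
  (eval_eq_eval_mv_eval' ![t] u P).symm

theorem eventually_eval_ne_zero {q : MvPolynomial (Fin 1) ℚ} (hq : q ≠ 0) :
    ∀ᶠ v : ℕ in atTop, eval ![(v : ℚ)] q ≠ 0 := by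
  set p : Polynomial ℚ := aeval (fun _ => Polynomial.X) q with hp
  have heval : ∀ t : ℚ, p.eval t = eval ![t] q := by
    intro t
    rw [hp, ← Polynomial.coe_aeval_eq_eval, ← coe_aeval_eq_eval]
    change ((Polynomial.aeval t).comp (aeval fun _ => Polynomial.X)) q = aeval _ q
    congr 1
    ext i
    fin_cases i
    simp
  have hp0 : p ≠ 0 := by
    intro h0
    refine hq (MvPolynomial.funext fun w => ?_)
    have := heval (w 0)
    rw [h0, Polynomial.eval_zero] at this
    rw [map_zero, this]
    congr 1
    congr 1
    ext i
    fin_cases i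
    rfl
  filter_upwards [(tendsto_natCast_atTop_atTop (R := ℚ)).eventually
    (Polynomial.eventually_atTop_not_isRoot p hp0)] with v hv
  rw [← heval]
  exact hv

/-- The leading coefficient of `P` in `u` is a nonzero polynomial in `v`, so it vanishes at no large
`v`. -/
theorem eventually_natDegree_slice {P : MvPolynomial (Fin 2) ℚ} (hP : P ≠ 0) :
    ∀ᶠ v : ℕ in atTop, slice P v ≠ 0 ∧ (slice P v).natDegree = degreeOf 0 P := by
  have h0 : (finSuccEquiv ℚ 1 P).leadingCoeff ≠ 0 := by
    rw [Polynomial.leadingCoeff_ne_zero]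
    exact (map_ne_zero_iff _ (finSuccEquiv ℚ 1).injective).2 hP
  filter_upwards [eventually_eval_ne_zero h0] with v hv
  refine ⟨fun h => hv ?_, ?_⟩
  · have := congrArg (fun p => p.coeff (finSuccEquiv ℚ 1 P).natDegree) h
    simpa [slice] using this
  · rw [slice, Polynomial.natDegree_map_of_leadingCoeff_ne_zero _ hv, natDegree_finSuccEquiv]

theorem slice_eq_of_infinite {P Q : MvPolynomial (Fin 2) ℚ} {t : ℚ} {u₁ : ℕ}
    (h : ∀ u : ℕ, u₁ ≤ u → eval ![(u : ℚ), t] P = eval ![(u : ℚ), t] Q) :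
    slice P t = slice Q t := by
  refine Polynomial.eq_of_infinite_eval_eq _ _ (Set.Infinite.mono ?_
    ((Set.Ici_infinite u₁).image (Nat.cast_injective (R := ℚ)).injOn))
  rintro _ ⟨u, hu, rfl⟩
  simpa [eval_slice] using h u hu

/-- Gives uniqueness of the Hilbert polynomial: a nonzero difference would have a nonzero slice at
some `v ≥ v₀`, yet that slice vanishes at all large `u`. -/
theorem eq_of_eval_eq_on_region {P Q : MvPolynomial (Fin 2) ℚ} {d u₀ v₀ : ℕ}
    (h : ∀ u v : ℕ, d * v + u₀ ≤ u → v₀ ≤ v →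
      eval ![(u : ℚ), (v : ℚ)] P = eval ![(u : ℚ), (v : ℚ)] Q) : P = Q := by
  rw [← sub_eq_zero]
  by_contra hne
  obtain ⟨v, ⟨hv, -⟩, hv₀⟩ :=
    ((eventually_natDegree_slice hne).and (eventually_ge_atTop v₀)).exists
  refine hv ?_
  have := slice_eq_of_infinite (P := P) (Q := Q) fun u hu => h u v hu hv₀
  simpa [slice, sub_eq_zero] using this

theorem eval_aeval_X {σ : Type*} (f : σ → ℚ) (i : σ) (p : Polynomial ℚ) :
    eval f (Polynomial.aeval (X i) p) = p.eval (f i) := by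
  rw [← coe_aeval_eq_eval, ← Polynomial.coe_aeval_eq_eval]
  change aeval f _ = _
  rw [← Polynomial.aeval_algHom_apply, aeval_X]

theorem exists_forwardDifference_eq_left (Q : MvPolynomial (Fin 2) ℚ) :
    ∃ P : MvPolynomial (Fin 2) ℚ, ∀ u t : ℚ, eval ![u + 1, t] P - eval ![u, t] P =
      eval ![u, t] Q := by
  induction Q using MvPolynomial.induction_on' with
  | add a b ha hb =>
    obtain ⟨p, hp⟩ := ha
    obtain ⟨p', hp'⟩ := hb
    refine ⟨p + p', fun u t => ?_⟩
    rw [map_add, map_add, map_add, ← hp u t, ← hp' u t]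
    ring
  | monomial m a =>
    obtain ⟨p, hp⟩ := exists_forwardDifference_eq (Polynomial.X ^ (m 0))
    refine ⟨C a * Polynomial.aeval (X 0) p * X 1 ^ (m 1), fun u t => ?_⟩
    have h := hp u
    simp only [map_mul, eval_aeval_X, eval_C, map_pow, eval_X, eval_monomial]
    rw [Finsupp.prod_fintype _ _ (by simp), Fin.prod_univ_two]
    simp only [Matrix.cons_val_zero, Matrix.cons_val_one]
    rw [Polynomial.eval_pow, Polynomial.eval_X] at h
    rw [← h]
    ring

theorem exists_eval_shift (P : MvPolynomial (Fin 2) ℚ) (a b : ℚ) :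
    ∃ Q : MvPolynomial (Fin 2) ℚ, ∀ u t : ℚ, eval ![u, t] Q = eval ![u + a, t + b] P := by
  refine ⟨bind₁ ![X 0 + C a, X 1 + C b] P, fun u t => ?_⟩
  rw [← coe_aeval_eq_eval, ← coe_aeval_eq_eval]
  change aeval _ _ = aeval _ _
  rw [aeval_bind₁]
  congr 2
  ext i
  fin_cases i <;> simp

/-- A function of two variables is polynomial on a region `u ≥ d v + u₀`, `v ≥ v₀` if its
differences in the directions `(1, 0)` and `(e, 1)` with `e ≤ d` are. -/
theorem exists_polynomial_of_differences {H : ℕ → ℕ → ℚ} {Q₁ Q₂ : MvPolynomial (Fin 2) ℚ}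
    {d e u₀ v₀ : ℕ} (hed : e ≤ d)
    (h₁ : ∀ u v : ℕ, d * v + u₀ ≤ u → v₀ ≤ v →
      H (u + 1) v - H u v = eval ![(u : ℚ), (v : ℚ)] Q₁)
    (h₂ : ∀ u v : ℕ, d * (v + 1) + u₀ ≤ u + e → v₀ ≤ v →
      H (u + e) (v + 1) - H u v = eval ![(u : ℚ), (v : ℚ)] Q₂) :
    ∃ P : MvPolynomial (Fin 2) ℚ, ∀ u v : ℕ, d * v + u₀ ≤ u → v₀ ≤ v →
      H u v = eval ![(u : ℚ), (v : ℚ)] P := by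
  obtain ⟨F, hF⟩ := exists_forwardDifference_eq_left Q₁
  -- Summation in `u` determines `H` up to this function of `v` alone, read off at the left end of
  -- the row. The second difference will show that it is polynomial.
  set c : ℕ → ℚ := fun v => H (d * v + u₀) v - eval ![((d * v + u₀ : ℕ) : ℚ), (v : ℚ)] F with hc
  have hHF : ∀ u v : ℕ, d * v + u₀ ≤ u → v₀ ≤ v →
      H u v = eval ![(u : ℚ), (v : ℚ)] F + c v := by
    intro u v hu hv
    induction u, hu using Nat.le_induction with
    | base => simp [hc]
    | succ u hu ih =>
      have h3 := h₁ u v hu hv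
      rw [← hF, ih] at h3
      push_cast
      linarith
  obtain ⟨F', hF'⟩ := exists_eval_shift F e 1
  set G := Q₂ - F' + F with hG
  have hGc : ∀ u v : ℕ, d * (v + 1) + u₀ ≤ u → v₀ ≤ v →
      eval ![(u : ℚ), (v : ℚ)] G = c (v + 1) - c v := by
    intro u v hu hv
    have h3 := h₂ u v (by omega) hv
    rw [hHF u v (by rw [mul_add] at hu; omega) hv, hHF (u + e) (v + 1) (by omega) (by omega)] at h3
    rw [hG, map_add, map_sub, ← h3, hF']
    push_cast
    ring
  -- For fixed `v` the polynomial `G(·, v)` is constant at large `u`, hence constant, and may be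
  -- evaluated at `u = 0`, outside the region.
  have hG0 : ∀ v : ℕ, v₀ ≤ v → eval ![0, (v : ℚ)] G = c (v + 1) - c v := by
    intro v hv
    have := slice_eq_of_infinite (P := G) (Q := C (c (v + 1) - c v)) (t := (v : ℚ))
      (u₁ := d * (v + 1) + u₀) fun u hu => by rw [hGc u v hu hv, eval_C]
    have h4 := congrArg (Polynomial.eval 0) this
    rwa [eval_slice, eval_slice, eval_C] at h4
  set g : Polynomial ℚ := aeval ![0, Polynomial.X] G with hg
  have hgG : ∀ t : ℚ, g.eval t = eval ![0, t] G := by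
    intro t
    rw [hg, ← Polynomial.coe_aeval_eq_eval, ← coe_aeval_eq_eval]
    change ((Polynomial.aeval t).comp (aeval ![0, Polynomial.X])) G = aeval _ G
    congr 1
    ext i
    fin_cases i <;> simp
  obtain ⟨p, hp⟩ := exists_forwardDifference_eq g
  have hcp : ∀ v : ℕ, v₀ ≤ v → c v = p.eval (v : ℚ) + (c v₀ - p.eval (v₀ : ℚ)) := by
    intro v hv
    induction v, hv using Nat.le_induction with
    | base => ring
    | succ v hv ih =>
      have h3 := hp v
      have h4 := hG0 v hv
      rw [hgG, h4] at h3
      push_cast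
      linarith
  refine ⟨F + Polynomial.aeval (X 1) p + C (c v₀ - p.eval (v₀ : ℚ)), fun u v hu hv => ?_⟩
  rw [hHF u v hu hv, hcp v hv, map_add, map_add, eval_aeval_X, eval_C,
    Matrix.cons_val_one, Matrix.cons_val_fin_one]
  ring

end Bivariate

/-! ### Bigraded pieces are spanned by monomials. -/

section Grading

variable {k R : Type*} [Field k] [CommRing R] [Algebra k R]

/-- The homogeneous pieces of a graded algebra are spanned by the members of the same degree of
any homogeneous spanning family. -/
theorem piece_eq_span_of_span_eq_top {ι κ : Type*} [DecidableEq κ] [AddMonoid κ]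
    (𝒜 : κ → Submodule k R) [GradedAlgebra 𝒜] {f : ι → R} {g : ι → κ}
    (hfg : ∀ i, f i ∈ 𝒜 (g i)) (hf : Submodule.span k (Set.range f) = ⊤) (w : κ) :
    𝒜 w = Submodule.span k (f '' {i | g i = w}) := by
  refine le_antisymm (fun a ha => ?_) ?_
  · have key : ∀ b ∈ Submodule.span k (Set.range f),
        (DirectSum.decompose 𝒜 b w : R) ∈ Submodule.span k (f '' {i | g i = w}) := by
      intro b hb
      induction hb using Submodule.span_induction with
      | mem b hb =>
        obtain ⟨i, rfl⟩ := hb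
        by_cases hi : g i = w
        · subst hi
          rw [DirectSum.decompose_of_mem_same 𝒜 (hfg i)]
          exact Submodule.subset_span ⟨i, rfl, rfl⟩
        · rw [DirectSum.decompose_of_mem_ne 𝒜 (hfg i) hi]
          exact zero_mem _
      | zero => simp
      | add b c _ _ hb hc =>
        rw [DirectSum.decompose_add]
        exact add_mem hb hc
      | smul c b _ hb =>
        rw [DirectSum.decompose_smul]
        exact Submodule.smul_mem _ c hb
    have := key a (hf ▸ Submodule.mem_top)
    rwa [DirectSum.decompose_of_mem_same 𝒜 ha] at this
  · rw [Submodule.span_le]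
    rintro _ ⟨i, rfl, rfl⟩
    exact hfg i

/-- The monomial `x^a y^b`. -/
def mon {n r : ℕ} (x : Fin n → R) (y : Fin r → R) (p : (Fin n → ℕ) × (Fin r → ℕ)) : R :=
  (∏ i, x i ^ p.1 i) * ∏ j, y j ^ p.2 j

/-- The bidegree of the monomial `x^a y^b`. -/
def bideg {n r : ℕ} (d : Fin r → ℕ) (p : (Fin n → ℕ) × (Fin r → ℕ)) : ℕ × ℕ :=
  (∑ i, p.1 i + ∑ j, p.2 j * d j, ∑ j, p.2 j)

variable {n r : ℕ} {x : Fin n → R} {y : Fin r → R} {d : Fin r → ℕ}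

theorem mon_mul (p q : (Fin n → ℕ) × (Fin r → ℕ)) :
    mon x y p * mon x y q = mon x y (p + q) := by
  simp only [mon, Prod.fst_add, Prod.snd_add, Pi.add_apply, pow_add, Finset.prod_mul_distrib]
  ring

theorem mon_zero : mon x y 0 = 1 := by simp [mon]

theorem mon_single_left (i : Fin n) : mon x y (Pi.single i 1, 0) = x i := by
  simp [mon, Pi.single_apply]

theorem mon_single_right (j : Fin r) : mon x y (0, Pi.single j 1) = y j := by
  simp [mon, Pi.single_apply]

theorem span_mon_eq_top (hgen : Algebra.adjoin k (Set.range x ∪ Set.range y) = ⊤) :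
    Submodule.span k (Set.range (mon x y)) = ⊤ := by
  rw [← Algebra.top_toSubmodule, ← hgen, Algebra.adjoin_eq_span]
  refine le_antisymm (Submodule.span_le.2 ?_) (Submodule.span_mono fun a ha => ?_)
  · rintro _ ⟨p, rfl⟩
    have : mon x y p ∈ Submonoid.closure (Set.range x ∪ Set.range y) :=
      Submonoid.mul_mem _
        (Submonoid.prod_mem _ fun i _ =>
          Submonoid.pow_mem _ (Submonoid.mem_closure_of_mem (Set.mem_union_left _ (Set.mem_range_self i))) _)
        (Submonoid.prod_mem _ fun j _ =>
          Submonoid.pow_mem _ (Submonoid.mem_closure_of_mem (Set.mem_union_right _ (Set.mem_range_self j))) _)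
    exact Submodule.subset_span this
  · induction ha using Submonoid.closure_induction with
    | mem a ha =>
      rcases ha with ⟨i, rfl⟩ | ⟨j, rfl⟩
      · exact ⟨_, mon_single_left i⟩
      · exact ⟨_, mon_single_right j⟩
    | one => exact ⟨0, mon_zero⟩
    | mul a b _ _ ha hb =>
      obtain ⟨p, rfl⟩ := ha
      obtain ⟨q, rfl⟩ := hb
      exact ⟨p + q, (mon_mul p q).symm⟩

variable {𝒜 : ℕ × ℕ → Submodule k R} [GradedAlgebra 𝒜]

theorem mon_mem (hx : ∀ i, x i ∈ 𝒜 (1, 0)) (hy : ∀ j, y j ∈ 𝒜 (d j, 1))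
    (p : (Fin n → ℕ) × (Fin r → ℕ)) : mon x y p ∈ 𝒜 (bideg d p) := by
  have h1 : ∏ i, x i ^ p.1 i ∈ 𝒜 (∑ i, p.1 i • (1, 0)) :=
    SetLike.prod_mem_graded _ _ _ fun i _ => SetLike.pow_mem_graded _ (hx i)
  have h2 : ∏ j, y j ^ p.2 j ∈ 𝒜 (∑ j, p.2 j • (d j, 1)) :=
    SetLike.prod_mem_graded _ _ _ fun j _ => SetLike.pow_mem_graded _ (hy j)
  have h3 : bideg d p = ∑ i, p.1 i • (1, 0) + ∑ j, p.2 j • (d j, 1) := by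
    ext <;> simp [bideg, Prod.fst_sum, Prod.snd_sum]
  rw [h3]
  exact SetLike.GradedMul.mul_mem h1 h2

variable (hx : ∀ i, x i ∈ 𝒜 (1, 0)) (hy : ∀ j, y j ∈ 𝒜 (d j, 1))
    (hgen : Algebra.adjoin k (Set.range x ∪ Set.range y) = ⊤)

include hx hy hgen

theorem piece_eq_span_mon (w : ℕ × ℕ) :
    𝒜 w = Submodule.span k (mon x y '' {p | bideg d p = w}) :=
  piece_eq_span_of_span_eq_top 𝒜 (mon_mem hx hy) (span_mon_eq_top hgen) w

theorem finite_piece (w : ℕ × ℕ) : Module.Finite k (𝒜 w) := by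
  have hfin : {p : (Fin n → ℕ) × (Fin r → ℕ) | bideg d p = w}.Finite := by
    refine ((Set.finite_Icc (0 : Fin n → ℕ) fun _ => w.1).prod
      (Set.finite_Icc (0 : Fin r → ℕ) fun _ => w.2)).subset ?_
    rintro ⟨a, b⟩ rfl
    refine ⟨⟨fun _ => Nat.zero_le _, fun i => ?_⟩, fun _ => Nat.zero_le _, fun j => ?_⟩
    · exact (Finset.single_le_sum (f := a) (fun _ _ => Nat.zero_le _) (Finset.mem_univ i)).trans
        (Nat.le_add_right _ _)
    · exact Finset.single_le_sum (f := b) (fun _ _ => Nat.zero_le _) (Finset.mem_univ j)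
  rw [piece_eq_span_mon hx hy hgen w]
  exact Module.Finite.span_of_finite k (hfin.image _)

/-- A graded piece lies in an ideal containing all `x_i` once its first degree is large. -/
theorem piece_le_of_forall_left {I : Ideal R} (hI : ∀ i, x i ∈ I) {u v : ℕ}
    (huv : Finset.univ.sup d * v < u) {a : R} (ha : a ∈ 𝒜 (u, v)) : a ∈ I := by
  suffices 𝒜 (u, v) ≤ I.restrictScalars k from this ha
  rw [piece_eq_span_mon hx hy hgen, Submodule.span_le]
  rintro _ ⟨⟨a, b⟩, hab, rfl⟩
  simp only [bideg, Set.mem_ofPred_eq, Prod.mk.injEq] at hab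
  obtain ⟨h1, h2⟩ := hab
  have hle : ∑ j, b j * d j ≤ Finset.univ.sup d * v := by
    rw [← h2, mul_comm, Finset.sum_mul]
    exact Finset.sum_le_sum fun j _ => Nat.mul_le_mul_left _ (Finset.le_sup (Finset.mem_univ j))
  obtain ⟨i, -, hi⟩ := Finset.exists_ne_zero_of_sum_ne_zero (s := Finset.univ) (f := a) (by omega)
  exact I.mul_mem_right _ (I.mem_of_dvd (Finset.dvd_prod_of_mem _ (Finset.mem_univ i))
    (I.pow_mem_of_mem (hI i) _ (Nat.pos_of_ne_zero hi)))

theorem piece_le_of_forall_right {I : Ideal R} (hI : ∀ j, y j ∈ I) {u v : ℕ}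
    (hv : 0 < v) {a : R} (ha : a ∈ 𝒜 (u, v)) : a ∈ I := by
  suffices 𝒜 (u, v) ≤ I.restrictScalars k from this ha
  rw [piece_eq_span_mon hx hy hgen, Submodule.span_le]
  rintro _ ⟨⟨a, b⟩, hab, rfl⟩
  simp only [bideg, Set.mem_ofPred_eq, Prod.mk.injEq] at hab
  obtain ⟨h1, h2⟩ := hab
  obtain ⟨j, -, hj⟩ := Finset.exists_ne_zero_of_sum_ne_zero (s := Finset.univ) (f := b) (by omega)
  exact I.mul_mem_left _ (I.mem_of_dvd (Finset.dvd_prod_of_mem _ (Finset.mem_univ j))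
    (I.pow_mem_of_mem (hI j) _ (Nat.pos_of_ne_zero hj)))

end Grading

/-! ### Additivity of the Hilbert function. -/

section Exact

variable {k R : Type*} [Field k] [CommRing R] [Algebra k R]

theorem finrank_map_add_finrank_inf_ker {V U : Type*} [AddCommGroup V] [Module k V]
    [AddCommGroup U] [Module k U] (f : V →ₗ[k] U) (p : Submodule k V) [Module.Finite k p] :
    Module.finrank k (p.map f) + Module.finrank k (p ⊓ LinearMap.ker f : Submodule k V) =
      Module.finrank k p := by
  rw [← LinearMap.finrank_range_add_finrank_ker (f.domRestrict p), LinearMap.range_domRestrict,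
    LinearMap.ker_domRestrict]
  congr 1
  have := (Submodule.comap p.subtype (LinearMap.ker f)).equivMapOfInjective p.subtype
    p.injective_subtype
  rw [this.finrank_eq, Submodule.map_comap_subtype]

theorem finrank_map_eq_of_ker_eq {V U U' : Type*} [AddCommGroup V] [Module k V]
    [AddCommGroup U] [Module k U] [AddCommGroup U'] [Module k U'] (f : V →ₗ[k] U)
    (f' : V →ₗ[k] U') (h : LinearMap.ker f = LinearMap.ker f') (p : Submodule k V)
    [Module.Finite k p] :
    Module.finrank k (p.map f) = Module.finrank k (p.map f') := by
  have h1 := finrank_map_add_finrank_inf_ker f p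
  have h2 := finrank_map_add_finrank_inf_ker f' p
  rw [h] at h1
  omega

/-- The ideal `I : z`. -/
def colonElem (I : Ideal R) (z : R) : Ideal R :=
  Submodule.comap (LinearMap.mulLeft R z) I

theorem mem_colonElem {I : Ideal R} {z a : R} : a ∈ colonElem I z ↔ z * a ∈ I := Iff.rfl

theorem le_colonElem (I : Ideal R) (z : R) : I ≤ colonElem I z :=
  fun _ ha => I.mul_mem_left z ha

variable {𝒜 : ℕ × ℕ → Submodule k R} [GradedAlgebra 𝒜]

theorem isHomogeneous_colonElem {I : Ideal R} (hI : I.IsHomogeneous 𝒜) {z : R} {e : ℕ × ℕ}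
    (hz : z ∈ 𝒜 e) : (colonElem I z).IsHomogeneous 𝒜 := by
  intro i a ha
  rw [mem_colonElem, ← DirectSum.coe_decompose_mul_add_of_left_mem 𝒜 hz]
  exact hI _ ha

theorem isHomogeneous_sup_span {I : Ideal R} (hI : I.IsHomogeneous 𝒜) {z : R} {e : ℕ × ℕ}
    (hz : z ∈ 𝒜 e) : (I ⊔ Ideal.span {z}).IsHomogeneous 𝒜 :=
  hI.sup (Ideal.homogeneous_span 𝒜 _ (by rintro _ rfl; exact ⟨e, hz⟩))

/-- Additivity of the Hilbert function along `0 → R/(I : z) → R/I → R/(I + z) → 0`. -/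
theorem hilbertFunction_quot_add [hfin : ∀ w, Module.Finite k (𝒜 w)] {I : Ideal R}
    (hI : I.IsHomogeneous 𝒜) {z : R} {e f : ℕ} (hz : z ∈ 𝒜 (e, f)) (u v : ℕ) :
    hilbertFunction (quotGrading 𝒜 I) (u + e) (v + f) =
      hilbertFunction (quotGrading 𝒜 (colonElem I z)) u v +
        hilbertFunction (quotGrading 𝒜 (I ⊔ Ideal.span {z})) (u + e) (v + f) := by
  set φ : R →ₗ[k] R ⧸ I := (Ideal.Quotient.mkₐ k I).toLinearMap with hφ
  set ψ : R ⧸ I →ₗ[k] R ⧸ (I ⊔ Ideal.span {z}) :=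
    (Ideal.Quotient.factorₐ k (le_sup_left : I ≤ I ⊔ Ideal.span {z})).toLinearMap with hψ
  set μ : R →ₗ[k] R ⧸ I := φ ∘ₗ LinearMap.mulLeft k z with hμ
  have hφ0 : ∀ a, φ a = 0 ↔ a ∈ I := fun a => Ideal.Quotient.eq_zero_iff_mem
  have hψφ : ∀ a, ψ (φ a) = (Ideal.Quotient.mkₐ k (I ⊔ Ideal.span {z})).toLinearMap a :=
    fun a => rfl
  have h1 := finrank_map_add_finrank_inf_ker ψ ((𝒜 (u + e, v + f)).map φ)
  have h2 : ((𝒜 (u + e, v + f)).map φ).map ψ =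
      quotGrading 𝒜 (I ⊔ Ideal.span {z}) (u + e, v + f) := by
    rw [← Submodule.map_comp]
    rfl
  have h3 : (𝒜 (u + e, v + f)).map φ ⊓ LinearMap.ker ψ = (𝒜 (u, v)).map μ := by
    apply le_antisymm
    · rintro _ ⟨⟨a, ha, rfl⟩, hker⟩
      rw [SetLike.mem_coe, LinearMap.mem_ker, hψφ] at hker
      have hmem : a ∈ I ⊔ Ideal.span {z} := Ideal.Quotient.eq_zero_iff_mem.1 hker
      obtain ⟨i, hi, b, hb, rfl⟩ := Submodule.mem_sup.1 hmem
      obtain ⟨c, rfl⟩ := Ideal.mem_span_singleton'.1 hb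
      -- In `i + cz` of bidegree `(u+e, v+f)` only the component of `c` in bidegree `(u, v)` matters
      -- modulo `I`, because `I` is homogeneous.
      refine ⟨(DirectSum.decompose 𝒜 c (u, v) : R), SetLike.coe_mem _, ?_⟩
      have h4 := DirectSum.decompose_of_mem_same 𝒜 ha
      have h5 : (u + e, v + f) = (e, f) + (u, v) := by simp [add_comm]
      rw [DirectSum.decompose_add, DirectSum.add_apply, Submodule.coe_add, mul_comm c z] at h4
      rw [h5, DirectSum.coe_decompose_mul_add_of_left_mem 𝒜 hz, ← h5] at h4
      rw [mul_comm c z, ← h4, map_add, (hφ0 _).2 (hI _ hi), zero_add]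
      rfl
    · rintro _ ⟨a, ha, rfl⟩
      refine ⟨⟨z * a, ?_, rfl⟩, ?_⟩
      · have := SetLike.GradedMul.mul_mem hz ha
        rwa [Prod.mk_add_mk, add_comm e, add_comm f] at this
      · change ψ (φ (z * a)) = 0
        rw [hψφ]
        exact Ideal.Quotient.eq_zero_iff_mem.2
          (Ideal.mul_mem_right _ _ (Ideal.mem_sup_right (Ideal.mem_span_singleton_self z)))
  -- Multiplication by `z` into `R/I` and the projection to `R/(I : z)` have the same kernel.
  have h4 : Module.finrank k ((𝒜 (u, v)).map μ) =
      Module.finrank k (quotGrading 𝒜 (colonElem I z) (u, v)) := by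
    refine finrank_map_eq_of_ker_eq _ _ ?_ _
    ext a
    rw [LinearMap.mem_ker, LinearMap.mem_ker]
    exact (hφ0 _).trans (Ideal.Quotient.eq_zero_iff_mem (I := colonElem I z)).symm
  rw [h2, h3, h4] at h1
  rw [hilbertFunction, hilbertFunction, hilbertFunction,
    add_comm (Module.finrank k (quotGrading 𝒜 (colonElem I z) (u, v))), h1]
  rfl

end Exact

/-! ### Existence of the Hilbert polynomial. -/

section Existence

variable {k R : Type*} [Field k] [CommRing R] [Algebra k R]
  {𝒜 : ℕ × ℕ → Submodule k R} [GradedAlgebra 𝒜]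

theorem exists_hilbertPolynomial_of_colon [∀ w, Module.Finite k (𝒜 w)] {I : Ideal R}
    (hI : I.IsHomogeneous 𝒜) {z : R} {e f D : ℕ} (hz : z ∈ 𝒜 (e, f))
    (h₁ : ∃ P, IsHilbertPolynomial (quotGrading 𝒜 (colonElem I z)) D P)
    (h₂ : ∃ P, IsHilbertPolynomial (quotGrading 𝒜 (I ⊔ Ideal.span {z})) D P) :
    ∃ P, IsHilbertPolynomial (quotGrading 𝒜 I) D P := by
  obtain ⟨P₁, u₁, v₁, h₁⟩ := h₁
  obtain ⟨P₂, u₂, v₂, h₂⟩ := h₂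
  obtain ⟨Q, hQ⟩ := exists_eval_shift P₁ (-e) (-f)
  refine ⟨Q + P₂, u₁ + u₂ + e, v₁ + v₂ + f, fun u v hu hv => ?_⟩
  obtain ⟨v', rfl⟩ : ∃ v', v = v' + f := ⟨v - f, by omega⟩
  rw [mul_add] at hu
  obtain ⟨u', rfl⟩ : ∃ u', u = u' + e := ⟨u - e, by omega⟩
  rw [hilbertFunction_quot_add hI hz, Nat.cast_add, h₁ u' v' (by omega) (by omega),
    h₂ (u' + e) (v' + f) (by rw [mul_add]; omega) (by omega), map_add, hQ]
  push_cast
  simp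

/-- With `I : x = I`, additivity says that the difference of the Hilbert function of `R/I` in
direction `(1,0)` is the shifted Hilbert function of `R/(I + (x))`; likewise for `y` and `(e,1)`. -/
theorem exists_hilbertPolynomial_of_nonzerodivisors [∀ w, Module.Finite k (𝒜 w)] {I : Ideal R}
    (hI : I.IsHomogeneous 𝒜) {x y : R} {e D : ℕ} (he : e ≤ D) (hx : x ∈ 𝒜 (1, 0))
    (hy : y ∈ 𝒜 (e, 1)) (hIx : colonElem I x = I) (hIy : colonElem I y = I)
    (h₁ : ∃ P, IsHilbertPolynomial (quotGrading 𝒜 (I ⊔ Ideal.span {x})) D P)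
    (h₂ : ∃ P, IsHilbertPolynomial (quotGrading 𝒜 (I ⊔ Ideal.span {y})) D P) :
    ∃ P, IsHilbertPolynomial (quotGrading 𝒜 I) D P := by
  obtain ⟨P₁, u₁, v₁, h₁⟩ := h₁
  obtain ⟨P₂, u₂, v₂, h₂⟩ := h₂
  obtain ⟨Q₁, hQ₁⟩ := exists_eval_shift P₁ 1 0
  obtain ⟨Q₂, hQ₂⟩ := exists_eval_shift P₂ e 1
  obtain ⟨P, hP⟩ := exists_polynomial_of_differences (Q₁ := Q₁) (Q₂ := Q₂)
    (H := fun u v => (hilbertFunction (quotGrading 𝒜 I) u v : ℚ)) (u₀ := u₁ + u₂)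
    (v₀ := v₁ + v₂) he
    (fun u v hu hv => by
      have h3 := hilbertFunction_quot_add hI hx u v
      have h4 := h₁ (u + 1) v (by omega) (by omega)
      rw [hIx, add_zero] at h3
      rw [h3, hQ₁, Nat.cast_add, h4]
      push_cast
      simp)
    (fun u v hu hv => by
      have h3 := hilbertFunction_quot_add hI hy u v
      have h4 := h₂ (u + e) (v + 1) (by omega) (by omega)
      rw [hIy] at h3
      rw [h3, hQ₂, Nat.cast_add, h4]
      push_cast
      simp)
  exact ⟨P, _, _, hP⟩

omit [GradedAlgebra 𝒜] in
theorem hilbertFunction_quot_eq_zero {I : Ideal R} {u v : ℕ} (h : ∀ a ∈ 𝒜 (u, v), a ∈ I) :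
    hilbertFunction (quotGrading 𝒜 I) u v = 0 := by
  have : quotGrading 𝒜 I (u, v) = ⊥ := by
    rw [eq_bot_iff]
    rintro _ ⟨a, ha, rfl⟩
    exact Ideal.Quotient.eq_zero_iff_mem.2 (h a ha)
  rw [hilbertFunction, this, finrank_bot]

variable {n r : ℕ} {x : Fin n → R} {y : Fin r → R} {d : Fin r → ℕ}
  (hx : ∀ i, x i ∈ 𝒜 (1, 0)) (hy : ∀ j, y j ∈ 𝒜 (d j, 1))
  (hgen : Algebra.adjoin k (Set.range x ∪ Set.range y) = ⊤)

include hgen in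
theorem isNoetherianRing_of_adjoin_eq_top : IsNoetherianRing R := by
  have : Algebra.FiniteType k R :=
    ⟨Subalgebra.fg_def.2 ⟨_, (Set.finite_range x).union (Set.finite_range y), hgen⟩⟩
  exact Algebra.FiniteType.isNoetherianRing k R

include hx hy hgen

/-- The generality in `I` is what makes Noetherian induction possible: `I : z` and `I + (z)` stay
homogeneous for homogeneous `z`. -/
theorem exists_hilbertPolynomial_quot (I : Ideal R) (hI : I.IsHomogeneous 𝒜) :
    ∃ P, IsHilbertPolynomial (quotGrading 𝒜 I) (Finset.univ.sup d) P := by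
  have := isNoetherianRing_of_adjoin_eq_top hgen
  have := finite_piece hx hy hgen
  induction I using IsNoetherian.induction with
  | hgt I ih =>
    have hsup : ∀ {z : R} {e : ℕ × ℕ}, z ∈ 𝒜 e → z ∉ I →
        ∃ P, IsHilbertPolynomial (quotGrading 𝒜 (I ⊔ Ideal.span {z})) (Finset.univ.sup d) P := by
      intro z e hz hzI
      refine ih _ (lt_of_le_of_ne le_sup_left fun h => hzI ?_) (isHomogeneous_sup_span hI hz)
      rw [h]
      exact Ideal.mem_sup_right (Ideal.mem_span_singleton_self z)
    have hcolon : ∀ {z : R} {e f : ℕ}, z ∈ 𝒜 (e, f) → z ∉ I → colonElem I z ≠ I →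
        ∃ P, IsHilbertPolynomial (quotGrading 𝒜 I) (Finset.univ.sup d) P := by
      intro z e f hz hzI hne
      exact exists_hilbertPolynomial_of_colon hI hz
        (ih _ (lt_of_le_of_ne (le_colonElem I z) hne.symm) (isHomogeneous_colonElem hI hz))
        (hsup hz hzI)
    by_cases hxI : ∀ i, x i ∈ I
    -- The offset `u₀ = 1` makes `u > dv`, so every monomial of bidegree `(u, v)` involves some
    -- `x_i`.
    · refine ⟨0, 1, 0, fun u v hu _ => ?_⟩
      rw [hilbertFunction_quot_eq_zero fun a ha =>
        piece_le_of_forall_left hx hy hgen hxI (by omega) ha]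
      simp
    by_cases hyI : ∀ j, y j ∈ I
    · refine ⟨0, 0, 1, fun u v _ hv => ?_⟩
      rw [hilbertFunction_quot_eq_zero fun a ha =>
        piece_le_of_forall_right hx hy hgen hyI (by omega) ha]
      simp
    push Not at hxI hyI
    obtain ⟨i, hi⟩ := hxI
    obtain ⟨j, hj⟩ := hyI
    by_cases hci : colonElem I (x i) = I
    swap
    · exact hcolon (hx i) hi hci
    by_cases hcj : colonElem I (y j) = I
    swap
    · exact hcolon (hy j) hj hcj
    exact exists_hilbertPolynomial_of_nonzerodivisors hI (Finset.le_sup (Finset.mem_univ j))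
      (hx i) (hy j) hci hcj (hsup (hx i) hi) (hsup (hy j) hj)

theorem exists_hilbertPolynomial :
    ∃ P, IsHilbertPolynomial 𝒜 (Finset.univ.sup d) P := by
  obtain ⟨P, u₀, v₀, h⟩ := exists_hilbertPolynomial_quot hx hy hgen ⊥ (Ideal.IsHomogeneous.bot 𝒜)
  refine ⟨P, u₀, v₀, fun u v hu hv => ?_⟩
  rw [← h u v hu hv, hilbertFunction, hilbertFunction]
  congr 1
  refine ((𝒜 (u, v)).equivMapOfInjective (Ideal.Quotient.mkₐ k ⊥).toLinearMap ?_).finrank_eq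
  exact (RingHom.injective_iff_ker_eq_bot (Ideal.Quotient.mk (⊥ : Ideal R))).2 Ideal.mk_ker

end Existence

/-! ### Krull dimension as a growth exponent. -/

section Growth

/-- Incomparability makes contraction of primes strictly monotone; lying over and going up lift
chains. -/
theorem ringKrullDim_eq_of_isIntegral {A B : Type*} [CommRing A] [CommRing B] [Algebra A B]
    [Algebra.IsIntegral A B] (hinj : Function.Injective (algebraMap A B)) :
    ringKrullDim B = ringKrullDim A := by
  refine le_antisymm ?_ ?_
  · exact Order.krullDim_le_of_strictMono (PrimeSpectrum.comap (algebraMap A B))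
      fun P Q hPQ => Ideal.IsIntegral.comap_lt_comap (R := A) hPQ
  · refine iSup_le fun l => ?_
    have : FaithfulSMul A B := (faithfulSMul_iff_algebraMap_injective A B).2 hinj
    obtain ⟨Q, hQ, hQl⟩ := (Ideal.nonempty_primesOver (S := B) (RelSeries.head l).asIdeal).some
    obtain ⟨L, hL, -⟩ := Ideal.exists_ltSeries_of_hasGoingUp l Q
    rw [← hL]
    exact Order.LTSeries.length_le_krullDim L

variable {k A : Type*} [Field k] [CommRing A] [Algebra k A]

theorem finrank_mul_le (M N : Submodule k A) [Module.Finite k M] [Module.Finite k N] :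
    Module.finrank k (M * N : Submodule k A) ≤ Module.finrank k M * Module.finrank k N := by
  rw [← Module.finrank_tensorProduct, ← Submodule.mulMap_range]
  exact LinearMap.finrank_range_le _

theorem finite_mul (M N : Submodule k A) [hM : Module.Finite k M] [hN : Module.Finite k N] :
    Module.Finite k (M * N : Submodule k A) :=
  Module.Finite.iff_fg.2 ((Module.Finite.iff_fg.1 hM).mul (Module.Finite.iff_fg.1 hN))

/-- A finitely generated submodule lies in a member of an exhaustive increasing family. -/
theorem exists_le_of_fg {V : Type*} [AddCommGroup V] [Module k V] {L : ℕ → Submodule k V}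
    (hL : Monotone L) (hex : ∀ a, ∃ u, a ∈ L u) {F : Submodule k V} (hF : F.FG) :
    ∃ u, F ≤ L u := by
  induction F, hF using Submodule.fg_induction with
  | singleton a =>
    obtain ⟨u, hu⟩ := hex a
    exact ⟨u, (Submodule.span_singleton_le_iff_mem a _).2 hu⟩
  | sup F G _ _ hF hG =>
    obtain ⟨u, hu⟩ := hF
    obtain ⟨v, hv⟩ := hG
    exact ⟨max u v, sup_le (hu.trans (hL (le_max_left _ _))) (hv.trans (hL (le_max_right _ _)))⟩

theorem finrank_restrictDegree (s u : ℕ) :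
    Module.finrank k (MvPolynomial.restrictDegree (Fin s) k u) = (u + 1) ^ s := by
  rw [MvPolynomial.restrictDegree,
    Module.finrank_eq_nat_card_basis (MvPolynomial.basisRestrictSupport k _)]
  let e : {m : Fin s →₀ ℕ | ∀ i, m i ≤ u} ≃ (Fin s → Fin (u + 1)) :=
    (Finsupp.equivFunOnFinite.subtypeEquiv (q := fun f : Fin s → ℕ => ∀ i, f i ≤ u)
      fun m => Iff.rfl).trans
      ((Equiv.subtypePiEquivPi (p := fun (_ : Fin s) (b : ℕ) => b ≤ u)).trans
        (Equiv.piCongrRight fun _ => (Equiv.subtypeEquivRight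
          fun _ => Nat.lt_succ_iff.symm).trans Fin.equivSubtype.symm))
  rw [Nat.card_congr e]
  simp

theorem restrictDegree_mul_le (s u v : ℕ) :
    MvPolynomial.restrictDegree (Fin s) k u * MvPolynomial.restrictDegree (Fin s) k v ≤
      MvPolynomial.restrictDegree (Fin s) k (u + v) := by
  rw [MvPolynomial.restrictDegree, MvPolynomial.restrictDegree,
    ← MvPolynomial.restrictSupport_add]
  refine MvPolynomial.restrictSupport_mono _ ?_
  rintro _ ⟨a, ha, b, hb, rfl⟩ i
  exact add_le_add (ha i) (hb i)

theorem restrictDegree_mono (s : ℕ) :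
    Monotone fun u => MvPolynomial.restrictDegree (Fin s) k u :=
  fun _ _ huv => MvPolynomial.restrictSupport_mono _ fun _ hm i => (hm i).trans huv

/-- A filtration of an algebra by finite-dimensional subspaces that is generated in degree one
grows polynomially, with exponent the Krull dimension of the algebra. -/
theorem exists_growth_bounds [Nontrivial A] [Algebra.FiniteType k A] (T : ℕ → Submodule k A)
    [∀ u, Module.Finite k (T u)] (hmono : Monotone T) (hone : 1 ∈ T 0)
    (hmul : ∀ u v, T u * T v ≤ T (u + v)) (hgen : ∀ u, T (u + 1) ≤ T 1 * T u)
    (hex : ∀ a, ∃ u, a ∈ T u) :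
    ∃ s N c c' : ℕ, ringKrullDim A = s ∧
      (∀ u, (u + 1) ^ s ≤ Module.finrank k (T (c * u))) ∧
      ∀ u, Module.finrank k (T u) ≤ N * (c * u + c') ^ s := by
  obtain ⟨s, φ, hinj, hfin⟩ := exists_finite_inj_algHom_of_fg k A
  -- Bounding each exponent, rather than the total degree, gives the exact dimension `(u+1)^s`.
  set D := fun u => MvPolynomial.restrictDegree (Fin s) k u with hD
  set E : ℕ → Submodule k A := fun u => (D u).map φ.toLinearMap with hE
  have hEfin : ∀ u, Module.Finite k (D u) := fun u => inferInstance
  have hEmono : Monotone E := fun u v huv => Submodule.map_mono (restrictDegree_mono s huv)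
  have hEmul : ∀ u v, E u * E v ≤ E (u + v) := fun u v => by
    rw [hE, ← Submodule.map_mul]
    exact Submodule.map_mono (restrictDegree_mul_le s u v)
  have hEone : 1 ∈ E 0 := ⟨1, by
    rw [← MvPolynomial.C_1]
    exact (MvPolynomial.mem_restrictDegree _ _ _).2 fun m hm i => by
      have := MvPolynomial.support_monomial_subset hm
      simp_all, map_one φ⟩
  have hDex : ∀ p, ∃ u, p ∈ D u := fun p => ⟨p.totalDegree,
    MvPolynomial.restrictTotalDegree_le_restrictDegree _ _ _
      ((MvPolynomial.mem_restrictTotalDegree _ _ _).2 le_rfl)⟩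
  have hDrank : ∀ u, Module.finrank k (E u) = (u + 1) ^ s := fun u => by
    rw [← finrank_restrictDegree (k := k) s u]
    exact (Submodule.equivMapOfInjective φ.toLinearMap hinj (D u)).finrank_eq.symm
  -- Lower bound.
  have hTpow : ∀ (b m : ℕ) (a : A), a ∈ T b → a ^ m ∈ T (m * b) := by
    intro b m a ha
    induction m with
    | zero => simpa using hone
    | succ m ih =>
      rw [pow_succ, Nat.succ_mul]
      exact hmul _ _ (Submodule.mul_mem_mul ih ha)
  have hTprod : ∀ (b : ℕ) (f : Fin s → A), (∀ i, f i ∈ T b) → ∀ S : Finset (Fin s),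
      ∏ i ∈ S, f i ∈ T (S.card * b) := by
    intro b f hf S
    induction S using Finset.cons_induction with
    | empty => simpa using hone
    | cons i S hi ih =>
      rw [Finset.prod_cons, Finset.card_cons, Nat.succ_mul, add_comm]
      exact hmul _ _ (Submodule.mul_mem_mul (hf i) ih)
  obtain ⟨c₀, hc₀⟩ := exists_le_of_fg hmono hex
    (F := Submodule.span k (Set.range fun i : Fin s => φ (MvPolynomial.X i)))
    (Submodule.fg_span (Set.finite_range _))
  have hlow : ∀ u, E u ≤ T (s * c₀ * u) := by
    intro u
    rw [hE]
    simp only [hD, MvPolynomial.restrictDegree, MvPolynomial.restrictSupport_eq_span]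
    rw [Submodule.map_span, Submodule.span_le]
    rintro _ ⟨_, ⟨m, hm, rfl⟩, rfl⟩
    have h1 := hTprod (u * c₀) (fun i => φ (MvPolynomial.X i) ^ m i) (fun i =>
      hmono (Nat.mul_le_mul_right c₀ (hm i)) (hTpow c₀ (m i) _
        (hc₀ (Submodule.subset_span (Set.mem_range_self i))))) Finset.univ
    rw [Finset.card_univ, Fintype.card_fin, mul_left_comm, mul_comm u] at h1
    have h2 : φ.toLinearMap (MvPolynomial.monomial m 1) =
        ∏ i, φ (MvPolynomial.X i) ^ m i := by
      rw [MvPolynomial.monomial_eq, Finsupp.prod_fintype _ _ (by simp)]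
      simp
    rw [SetLike.mem_coe, h2]
    simpa [mul_assoc] using h1
  -- Upper bound.
  let _ := φ.toRingHom.toAlgebra
  have : IsScalarTower k (MvPolynomial (Fin s) k) A := IsScalarTower.of_algHom φ
  have hfin' : Module.Finite (MvPolynomial (Fin s) k) A := hfin
  obtain ⟨S, hS⟩ := id hfin'
  set W : Submodule k A := Submodule.span k (S : Set A) with hW
  have hWfin : Module.Finite k W := Module.Finite.span_finset k S
  have hEWmono : Monotone fun u => E u * W :=
    fun u v huv => mul_le_mul' (hEmono huv) le_rfl
  have hEWex : ∀ a, ∃ u, a ∈ E u * W := by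
    intro a
    have ha : a ∈ Submodule.span (MvPolynomial (Fin s) k) (S : Set A) := hS ▸ Submodule.mem_top
    induction ha using Submodule.span_induction with
    | mem a ha =>
      refine ⟨0, ?_⟩
      rw [← one_mul a]
      exact Submodule.mul_mem_mul hEone (Submodule.subset_span ha)
    | zero => exact ⟨0, zero_mem _⟩
    | add a b _ _ ha hb =>
      obtain ⟨u, hu⟩ := ha
      obtain ⟨v, hv⟩ := hb
      exact ⟨max u v, add_mem (hEWmono (le_max_left u v) hu) (hEWmono (le_max_right u v) hv)⟩
    | smul p a _ ha =>
      obtain ⟨u, hu⟩ := ha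
      obtain ⟨v, hv⟩ := hDex p
      refine ⟨v + u, (mul_le_mul' (hEmul v u) le_rfl : E v * E u * W ≤ _) ?_⟩
      rw [mul_assoc, Algebra.smul_def]
      exact Submodule.mul_mem_mul ⟨p, hv, rfl⟩ hu
  -- As `T` is generated in degree one, a single inclusion `T 1 * W ≤ E c * W` controls every `T u`
  -- by iteration.
  obtain ⟨c, hc⟩ := exists_le_of_fg hEWmono hEWex (F := T 1 * W)
    ((Module.Finite.iff_fg.1 inferInstance : (T 1).FG).mul (Module.Finite.iff_fg.1 hWfin))
  obtain ⟨c', hc'⟩ := exists_le_of_fg hEWmono hEWex (F := T 0)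
    (Module.Finite.iff_fg.1 inferInstance)
  have hupp : ∀ u, T u ≤ E (c * u + c') * W := by
    intro u
    induction u with
    | zero => simpa using hc'
    | succ u ih =>
      calc T (u + 1) ≤ T 1 * T u := hgen u
        _ ≤ T 1 * (E (c * u + c') * W) := mul_le_mul' le_rfl ih
        _ = E (c * u + c') * (T 1 * W) := mul_left_comm _ _ _
        _ ≤ E (c * u + c') * (E c * W) := mul_le_mul' le_rfl hc
        _ = (E (c * u + c') * E c) * W := (mul_assoc _ _ _).symm
        _ ≤ E (c * u + c' + c) * W := mul_le_mul' (hEmul _ _) le_rfl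
        _ = E (c * (u + 1) + c') * W := by
          congr 2
          ring
  -- The sum `s * c₀ + c` serves both bounds at once; the `+ 1` in `c' + 1` is that of `dim E u =
  -- (u+1)^s`.
  refine ⟨s, Module.finrank k W, s * c₀ + c, c' + 1, ?_, fun u => ?_, fun u => ?_⟩
  · have : Algebra.IsIntegral (MvPolynomial (Fin s) k) A := Algebra.IsIntegral.of_finite _ _
    rw [ringKrullDim_eq_of_isIntegral (A := MvPolynomial (Fin s) k) hinj]
    simp
  · rw [← hDrank]
    refine Submodule.finrank_mono ((hlow u).trans (hmono ?_))
    exact Nat.mul_le_mul_right _ (Nat.le_add_right _ _)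
  · have := finite_mul (E (c * u + c')) W
    refine (Submodule.finrank_mono (hupp u)).trans ((finrank_mul_le _ _).trans ?_)
    rw [hDrank, mul_comm]
    refine Nat.mul_le_mul_left _ (Nat.pow_le_pow_left ?_ _)
    have := Nat.mul_le_mul_right u (Nat.le_add_left c (s * c₀))
    omega

end Growth

/-! ### Comparing one map with a finite family having the same common kernel. -/

section LinearAlgebra

variable {k : Type*} [Field k] {ι B V U : Type*} [AddCommGroup B] [Module k B]
  [AddCommGroup V] [Module k V] [AddCommGroup U] [Module k U]

theorem finite_finset_sup (S : Finset ι) (f : ι → Submodule k V)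
    [∀ i, Module.Finite k (f i)] : Module.Finite k (S.sup f : Submodule k V) := by
  induction S using Finset.cons_induction with
  | empty => rw [Finset.sup_empty]; infer_instance
  | cons i S hi ih => rw [Finset.sup_cons]; infer_instance

theorem finrank_finset_sup_le (S : Finset ι) (f : ι → Submodule k V)
    [∀ i, Module.Finite k (f i)] :
    Module.finrank k (S.sup f : Submodule k V) ≤ ∑ i ∈ S, Module.finrank k (f i) := by
  induction S using Finset.cons_induction with
  | empty => simp
  | cons i S hi ih =>
    have := finite_finset_sup S f
    rw [Finset.sup_cons, Finset.sum_cons]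
    exact (Submodule.finrank_add_le_finrank_add_finrank _ _).trans (Nat.add_le_add_left ih _)

variable [Fintype ι] {π : B →ₗ[k] V} {g : ι → B →ₗ[k] U} (hker : LinearMap.ker π = ⨅ i, LinearMap.ker (g i))
  (T : Submodule k B) [Module.Finite k T]

include hker

/-- Each `ker (g i)` contains `ker π`, so each image of `T` is at most as large as `T.map π`. -/
theorem finrank_sup_map_le :
    Module.finrank k (Finset.univ.sup fun i => T.map (g i) : Submodule k U) ≤
      Fintype.card ι * Module.finrank k (T.map π) := by
  refine (finrank_finset_sup_le _ _).trans ?_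
  rw [← smul_eq_mul, ← Finset.card_univ, ← Finset.sum_const]
  refine Finset.sum_le_sum fun i _ => ?_
  have h1 := finrank_map_add_finrank_inf_ker (g i) T
  have h2 := finrank_map_add_finrank_inf_ker π T
  have hle : T ⊓ LinearMap.ker π ≤ T ⊓ LinearMap.ker (g i) :=
    inf_le_inf_left _ (hker ▸ iInf_le _ i)
  have hfin : Module.Finite k (T ⊓ LinearMap.ker (g i) : Submodule k B) :=
    Submodule.finiteDimensional_inf_left _ _
  have h3 := Submodule.finrank_mono hle
  omega

/-- Up to isomorphism `T.map π` is the image of `T` under the product map `(g i)_i`, which lies in a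
power of the sum of the images. -/
theorem finrank_map_le_mul_sup :
    Module.finrank k (T.map π) ≤ Fintype.card ι *
      Module.finrank k (Finset.univ.sup fun i => T.map (g i) : Submodule k U) := by
  have hfin := finite_finset_sup Finset.univ fun i => T.map (g i)
  set Z : Submodule k U := Finset.univ.sup fun i => T.map (g i) with hZ
  have h1 : Module.finrank k (T.map π) = Module.finrank k (T.map (LinearMap.pi g)) :=
    finrank_map_eq_of_ker_eq _ _ (by rw [hker, LinearMap.ker_pi]) _
  have h2 : T.map (LinearMap.pi g) ≤ LinearMap.range (Z.subtype.compLeft ι) := by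
    rintro _ ⟨t, ht, rfl⟩
    refine ⟨fun i => ⟨g i t, ?_⟩, rfl⟩
    exact (Finset.le_sup (f := fun i => T.map (g i)) (Finset.mem_univ i)) ⟨t, ht, rfl⟩
  rw [h1]
  refine (Submodule.finrank_mono h2).trans ((LinearMap.finrank_range_le _).trans ?_)
  rw [Module.finrank_pi_fintype]
  simp

end LinearAlgebra

/-! ### Quotients of equal dimension, and a uniform annihilating power. -/

section KrullDim

variable {B : Type*} [CommRing B]

theorem unbotD_zero_mono {a b : WithBot ℕ∞} (h : a ≤ b) : a.unbotD 0 ≤ b.unbotD 0 := by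
  induction a with
  | bot => simp
  | coe a =>
    induction b with
    | bot => simp at h
    | coe b => simpa using h

/-- Two nested ideals that differ only at primes which form no proper chain have quotients of
equal dimension, up to the convention for the zero ring. -/
theorem ringDim_quotient_eq {I K : Ideal B} (hIK : I ≤ K) {X : Set B}
    (hX : ∀ P Q : PrimeSpectrum B, X ⊆ P.asIdeal → ¬ P < Q)
    (hK : ∀ x ∈ X, ∀ c ∈ K, ∃ m : ℕ, x ^ m * c ∈ I) :
    ringDim (B ⧸ I) = ringDim (B ⧸ K) := by
  refine le_antisymm ?_ (unbotD_zero_mono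
    (ringKrullDim_le_of_surjective (Ideal.Quotient.factor hIK)
      (Ideal.Quotient.factor_surjective hIK)))
  have key : ringKrullDim (B ⧸ I) ≤ (ringDim (B ⧸ K) : ℕ∞) := by
    rw [ringKrullDim_quotient]
    refine iSup_le fun l => ?_
    -- Chains of length zero need no prime over `K`: `B ⧸ K` may be the zero ring, but `ringDim` is
    -- then `0`.
    rcases Nat.eq_zero_or_pos l.length with h0 | hpos
    · rw [h0]
      exact WithBot.coe_le_coe.2 zero_le
    have hlt : (l 0).1 < (l ⟨1, by omega⟩).1 := l.strictMono (Fin.mk_lt_mk.2 Nat.zero_lt_one)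
    -- The bottom prime of a proper chain misses some `x ∈ X`. As it contains `x ^ m * c ∈ I` for
    -- each `c ∈ K`, it contains `K`, and so does the whole chain.
    obtain ⟨x, hx, hxP⟩ := Set.not_subset.1 fun h => hX _ _ h hlt
    have hK0 : K ≤ (l 0).1.asIdeal := by
      intro c hc
      obtain ⟨m, hm⟩ := hK x hx c hc
      have hm' : x ^ m * c ∈ (l 0).1.asIdeal := (l 0).2 hm
      rcases (l 0).1.2.mem_or_mem hm' with h | h
      · exact absurd ((l 0).1.2.mem_of_pow_mem m h) hxP
      · exact h
    let L : LTSeries (PrimeSpectrum.zeroLocus (K : Set B)) :=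
      { length := l.length
        toFun := fun i => ⟨(l i).1, fun c hc =>
          (show (l 0).1 ≤ (l i).1 from l.monotone (Fin.zero_le i)) (hK0 hc)⟩
        step := fun i => l.step i }
    have h1 : (l.length : WithBot ℕ∞) ≤ ringKrullDim (B ⧸ K) := by
      rw [ringKrullDim_quotient]
      exact Order.LTSeries.length_le_krullDim L
    have h2 := unbotD_zero_mono h1
    exact WithBot.coe_le_coe.2 h2
  have h3 := unbotD_zero_mono key
  rwa [WithBot.unbotD_coe] at h3

/-- The ideal is finitely generated, so the largest exponent among generators works for all its
elements. -/
theorem exists_pow_annihilates_zeroColonInfty [IsNoetherianRing B] (I : Ideal B) :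
    ∃ m : ℕ, ∀ a ∈ zeroColonInfty I, ∀ b ∈ I ^ m, b * a = 0 := by
  have key : ∀ N : Submodule B B, N.FG → N ≤ zeroColonInfty I →
      ∃ m : ℕ, ∀ a ∈ N, ∀ b ∈ I ^ m, b * a = 0 := by
    intro N hN
    induction N, hN using Submodule.fg_induction with
    | singleton a =>
      intro h
      obtain ⟨m, hm⟩ := h (Submodule.mem_span_singleton_self a)
      refine ⟨m, fun a' ha' b hb => ?_⟩
      obtain ⟨c, rfl⟩ := Submodule.mem_span_singleton.1 ha'
      rw [smul_eq_mul, mul_left_comm, hm b hb, mul_zero]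
    | sup N N' _ _ ih ih' =>
      intro h
      obtain ⟨m, hm⟩ := ih (le_sup_left.trans h)
      obtain ⟨m', hm'⟩ := ih' (le_sup_right.trans h)
      refine ⟨max m m', fun a ha b hb => ?_⟩
      obtain ⟨c, hc, c', hc', rfl⟩ := Submodule.mem_sup.1 ha
      rw [mul_add, hm c hc b (Ideal.pow_le_pow_right (le_max_left _ _) hb),
        hm' c' hc' b (Ideal.pow_le_pow_right (le_max_right _ _) hb), add_zero]
  exact key _ (IsNoetherian.noetherian _) le_rfl

end KrullDim

/-! ### Filtrations of the rows, and the algebra `R_0`. -/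

section RowFiltration

variable {k R : Type*} [Field k] [CommRing R] [Algebra k R]
  {𝒜 : ℕ × ℕ → Submodule k R} [GradedAlgebra 𝒜]

/-- The part `⊕_{i < u} R_(i,v)` of the row `R_v`. -/
def rowBelow (𝒜 : ℕ × ℕ → Submodule k R) (v u : ℕ) : Submodule k R :=
  (Finset.range u).sup fun i => 𝒜 (i, v)

theorem finrank_rowBelow [∀ w, Module.Finite k (𝒜 w)] (v u : ℕ) :
    Module.finrank k (rowBelow 𝒜 v u) = ∑ i ∈ Finset.range u, hilbertFunction 𝒜 i v := by
  induction u with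
  | zero =>
    rw [rowBelow, Finset.range_zero, Finset.sup_empty]
    simp
  | succ u ih =>
    have hfin : Module.Finite k (rowBelow 𝒜 v u) := finite_finset_sup _ _
    have hind := (DirectSum.Decomposition.isInternal 𝒜).submodule_iSupIndep (u, v)
    have hle : rowBelow 𝒜 v u ≤ ⨆ (j) (_ : j ≠ (u, v)), 𝒜 j := by
      refine Finset.sup_le fun i hi => le_iSup₂_of_le (i, v) (fun h => ?_) le_rfl
      rw [Finset.mem_range] at hi
      simp only [Prod.mk.injEq] at h
      omega
    have h1 := Submodule.finrank_sup_add_finrank_inf_eq (𝒜 (u, v)) (rowBelow 𝒜 v u)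
    rw [(hind.mono_right hle).eq_bot, finrank_bot, add_zero, ih] at h1
    rw [Finset.sum_range_succ, rowBelow, Finset.range_add_one, Finset.sup_insert]
    exact h1.trans (add_comm _ _)

variable {n r : ℕ} {x : Fin n → R} {y : Fin r → R} {d : Fin r → ℕ}

/-- The element `x_i` of `R_0`. -/
def xZero (hx : ∀ i, x i ∈ 𝒜 (1, 0)) (i : Fin n) : rowZero 𝒜 :=
  ⟨x i, (le_iSup (fun u : ℕ => 𝒜 (u, 0)) 1) (hx i)⟩

/-- The monomial `x^a` of `R_0`. -/
def monZero (hx : ∀ i, x i ∈ 𝒜 (1, 0)) (a : Fin n → ℕ) : rowZero 𝒜 :=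
  ∏ i, xZero hx i ^ a i

/-- The part `⊕_{i ≤ u} R_(i,0)` of `R_0`. -/
def rowZeroLE (hx : ∀ i, x i ∈ 𝒜 (1, 0)) (u : ℕ) : Submodule k (rowZero 𝒜) :=
  Submodule.span k (monZero hx '' {a | ∑ i, a i ≤ u})

theorem coe_monZero (hx : ∀ i, x i ∈ 𝒜 (1, 0)) (a : Fin n → ℕ) :
    (monZero hx a : R) = mon x y (a, 0) := by
  simp [monZero, mon, xZero]

theorem monZero_add (hx : ∀ i, x i ∈ 𝒜 (1, 0)) (a b : Fin n → ℕ) :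
    monZero hx (a + b) = monZero hx a * monZero hx b := by
  simp [monZero, pow_add, Finset.prod_mul_distrib]

variable (hx : ∀ i, x i ∈ 𝒜 (1, 0))

instance finite_rowZeroLE (u : ℕ) : Module.Finite k (rowZeroLE hx u) := by
  refine Module.Finite.span_of_finite k (Set.Finite.image _ ?_)
  refine (Set.finite_Icc (0 : Fin n → ℕ) fun _ => u).subset fun a ha =>
    ⟨fun _ => Nat.zero_le _, fun i => ?_⟩
  exact (Finset.single_le_sum (f := a) (fun _ _ => Nat.zero_le _) (Finset.mem_univ i)).trans ha

theorem monZero_mem_rowZeroLE {a : Fin n → ℕ} {u : ℕ} (ha : ∑ i, a i ≤ u) :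
    monZero hx a ∈ rowZeroLE hx u :=
  Submodule.subset_span ⟨a, ha, rfl⟩

theorem rowZeroLE_mono : Monotone (rowZeroLE hx) := fun _ _ huv =>
  Submodule.span_mono (Set.image_mono fun _ ha => le_trans ha huv)

theorem one_mem_rowZeroLE : 1 ∈ rowZeroLE hx 0 := by
  have : monZero hx 0 = 1 := by simp [monZero]
  rw [← this]
  exact monZero_mem_rowZeroLE hx (by simp)

theorem rowZeroLE_mul_le (u v : ℕ) :
    rowZeroLE hx u * rowZeroLE hx v ≤ rowZeroLE hx (u + v) := by
  rw [rowZeroLE, rowZeroLE, Submodule.span_mul_span, Submodule.span_le]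
  rintro _ ⟨_, ⟨a, ha, rfl⟩, _, ⟨b, hb, rfl⟩, rfl⟩
  change monZero hx a * monZero hx b ∈ _
  rw [← monZero_add]
  refine monZero_mem_rowZeroLE hx ?_
  simp only [Pi.add_apply, Finset.sum_add_distrib]
  exact add_le_add ha hb

theorem rowZeroLE_succ_le (u : ℕ) :
    rowZeroLE hx (u + 1) ≤ rowZeroLE hx 1 * rowZeroLE hx u := by
  rw [rowZeroLE, Submodule.span_le]
  rintro _ ⟨a, ha, rfl⟩
  have ha' : ∑ i, a i ≤ u + 1 := ha
  rcases Nat.lt_or_ge u (∑ i, a i) with h | h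
  · obtain ⟨i, -, hi⟩ := Finset.exists_ne_zero_of_sum_ne_zero (s := Finset.univ) (f := a)
      (by omega)
    obtain ⟨b, hsplit⟩ : ∃ b : Fin n → ℕ, a = Pi.single i 1 + b := by
      refine ⟨a - Pi.single i 1, ?_⟩
      ext j
      by_cases hj : j = i
      · subst hj
        simp only [Pi.add_apply, Pi.sub_apply, Pi.single_eq_same]
        omega
      · simp [hj]
    have hsum : ∑ j, a j = 1 + ∑ j, b j := by
      rw [hsplit]
      simp only [Pi.add_apply, Finset.sum_add_distrib]
      simp
    rw [hsplit, monZero_add]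
    exact Submodule.mul_mem_mul (monZero_mem_rowZeroLE hx (by simp))
      (monZero_mem_rowZeroLE hx (by omega))
  · rw [← one_mul (monZero hx a)]
    exact Submodule.mul_mem_mul (rowZeroLE_mono hx (Nat.zero_le 1) (one_mem_rowZeroLE hx))
      (monZero_mem_rowZeroLE hx h)

variable (hy : ∀ j, y j ∈ 𝒜 (d j, 1))
    (hgen : Algebra.adjoin k (Set.range x ∪ Set.range y) = ⊤)

include hy hgen

theorem exists_mem_rowZeroLE (c : rowZero 𝒜) : ∃ u, c ∈ rowZeroLE hx u := by
  suffices ∀ a ∈ row 𝒜 0, ∃ u, a ∈ (rowZeroLE hx u).map (rowZero 𝒜).val.toLinearMap by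
    obtain ⟨u, c', hc', h⟩ := this c c.2
    obtain rfl : c' = c := Subtype.ext h
    exact ⟨u, hc'⟩
  intro a ha
  induction ha using Submodule.iSup_induction' with
  | mem u a ha =>
    refine ⟨u, ?_⟩
    suffices 𝒜 (u, 0) ≤ (rowZeroLE hx u).map (rowZero 𝒜).val.toLinearMap from this ha
    rw [piece_eq_span_mon hx hy hgen, Submodule.span_le]
    rintro _ ⟨⟨a, b⟩, hab, rfl⟩
    simp only [bideg, Set.mem_ofPred_eq, Prod.mk.injEq] at hab
    obtain ⟨h1, h2⟩ := hab
    obtain rfl : b = 0 := by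
      ext j
      exact Finset.sum_eq_zero_iff.1 h2 j (Finset.mem_univ j)
    exact ⟨monZero hx a, monZero_mem_rowZeroLE hx (by omega), coe_monZero hx a⟩
  | zero => exact ⟨0, zero_mem _⟩
  | add a b _ _ ha hb =>
    obtain ⟨u, hu⟩ := ha
    obtain ⟨v, hv⟩ := hb
    exact ⟨max u v, add_mem (Submodule.map_mono (rowZeroLE_mono hx (le_max_left u v)) hu)
      (Submodule.map_mono (rowZeroLE_mono hx (le_max_right u v)) hv)⟩

theorem adjoin_xZero : Algebra.adjoin k (Set.range (xZero hx)) = ⊤ := by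
  refine eq_top_iff.2 fun c _ => ?_
  obtain ⟨u, hu⟩ := exists_mem_rowZeroLE hx hy hgen c
  suffices rowZeroLE hx u ≤ Subalgebra.toSubmodule (Algebra.adjoin k (Set.range (xZero hx)))
    from this hu
  rw [rowZeroLE, Submodule.span_le]
  rintro _ ⟨a, -, rfl⟩
  exact Subalgebra.prod_mem _ fun i _ =>
    Subalgebra.pow_mem _ (Algebra.subset_adjoin (Set.mem_range_self i)) _

include hx in
theorem finiteType_rowZero : Algebra.FiniteType k (rowZero 𝒜) :=
  ⟨Subalgebra.fg_def.2 ⟨_, Set.finite_range _, adjoin_xZero hx hy hgen⟩⟩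

/-- The primes of `R_0` that contain all `x_i` are maximal. -/
theorem not_lt_of_forall_xZero_mem (P Q : PrimeSpectrum (rowZero 𝒜))
    (hP : Set.range (xZero hx) ⊆ P.asIdeal) : ¬ P < Q := by
  intro hPQ
  -- Since the `x_i` generate `R_0`, every element is a scalar modulo `P`; a larger prime would
  -- contain a nonzero scalar.
  have key : ∀ c : rowZero 𝒜, ∃ a : k, c - algebraMap k _ a ∈ P.asIdeal := by
    intro c
    have hc : c ∈ Algebra.adjoin k (Set.range (xZero hx)) := by
      rw [adjoin_xZero hx hy hgen]
      trivial
    induction hc using Algebra.adjoin_induction with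
    | mem c hc => exact ⟨0, by simpa using hP hc⟩
    | algebraMap a => exact ⟨a, by simp⟩
    | add b c _ _ hb hc =>
      obtain ⟨a, ha⟩ := hb
      obtain ⟨a', ha'⟩ := hc
      refine ⟨a + a', ?_⟩
      rw [map_add, add_sub_add_comm]
      exact add_mem ha ha'
    | mul b c _ _ hb hc =>
      obtain ⟨a, ha⟩ := hb
      obtain ⟨a', ha'⟩ := hc
      refine ⟨a * a', ?_⟩
      rw [map_mul]
      have : b * c - algebraMap k (rowZero 𝒜) a * algebraMap k (rowZero 𝒜) a' =
        c * (b - algebraMap k (rowZero 𝒜) a) +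
          algebraMap k (rowZero 𝒜) a * (c - algebraMap k (rowZero 𝒜) a') := by ring
      rw [this]
      exact add_mem (P.asIdeal.mul_mem_left _ ha) (P.asIdeal.mul_mem_left _ ha')
  refine hPQ.not_ge fun c hc => ?_
  obtain ⟨a, ha⟩ := key c
  have haQ : algebraMap k (rowZero 𝒜) a ∈ Q.asIdeal := by
    have := sub_mem hc (hPQ.le ha)
    rwa [sub_sub_cancel] at this
  obtain rfl : a = 0 := by
    by_contra ha0
    exact Q.2.ne_top (Ideal.eq_top_of_isUnit_mem _ haQ
      ((isUnit_iff_ne_zero.2 ha0).map (algebraMap k (rowZero 𝒜))))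
  simpa using ha

end RowFiltration

/-! ### The module `R_v` and its dimension. -/

section RowModule

variable {k R : Type*} [Field k] [CommRing R] [Algebra k R]
  {𝒜 : ℕ × ℕ → Submodule k R} [GradedAlgebra 𝒜]
  {n r : ℕ} {x : Fin n → R} {y : Fin r → R} {d : Fin r → ℕ}

/-- Multiplication by `y^b` as a map `R_0 → R`. -/
def mulMon (𝒜 : ℕ × ℕ → Submodule k R) [GradedAlgebra 𝒜] (x : Fin n → R) (y : Fin r → R)
    (b : Fin r → ℕ) : rowZero 𝒜 →ₗ[k] R :=
  LinearMap.mulRight k (mon x y (0, b)) ∘ₗ (rowZero 𝒜).val.toLinearMap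

theorem mulMon_apply (b : Fin r → ℕ) (c : rowZero 𝒜) :
    mulMon 𝒜 x y b c = c * mon x y (0, b) := rfl

theorem mulMon_monZero (hx : ∀ i, x i ∈ 𝒜 (1, 0)) (a : Fin n → ℕ) (b : Fin r → ℕ) :
    mulMon 𝒜 x y b (monZero hx a) = mon x y (a, b) := by
  rw [mulMon_apply, coe_monZero (y := y), mon_mul]
  simp

theorem mem_piAntidiag_univ {b : Fin r → ℕ} {v : ℕ} :
    b ∈ Finset.univ.piAntidiag v ↔ ∑ j, b j = v := by
  simp [Finset.mem_piAntidiag]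

variable (hx : ∀ i, x i ∈ 𝒜 (1, 0)) (hy : ∀ j, y j ∈ 𝒜 (d j, 1))
    (hgen : Algebra.adjoin k (Set.range x ∪ Set.range y) = ⊤)

/-- If `c` annihilates the monomials of degree `m` in `y`, it annihilates those of larger
degree. -/
theorem mul_mon_eq_zero {c : R} {m : ℕ} (hc : ∀ b : Fin r → ℕ, ∑ j, b j = m →
    c * mon x y (0, b) = 0) {t : ℕ} {b : Fin r → ℕ} (hb : ∑ j, b j = m + t) :
    c * mon x y (0, b) = 0 := by
  induction t generalizing b with
  | zero => exact hc b hb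
  | succ t ih =>
    obtain ⟨j, -, hj⟩ := Finset.exists_ne_zero_of_sum_ne_zero (s := Finset.univ) (f := b)
      (by omega)
    obtain ⟨b', rfl⟩ : ∃ b' : Fin r → ℕ, b = Pi.single j 1 + b' := by
      refine ⟨b - Pi.single j 1, ?_⟩
      ext i
      by_cases hi : i = j
      · subst hi
        simp only [Pi.add_apply, Pi.sub_apply, Pi.single_eq_same]
        omega
      · simp [hi]
    have hsum : ∑ i, b' i = m + t := by
      simp only [Pi.add_apply, Finset.sum_add_distrib] at hb
      rw [Finset.sum_pi_single' ] at hb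
      simp at hb
      omega
    have : mon x y (0, Pi.single j 1 + b') = mon x y (0, b') * mon x y (0, Pi.single j 1) := by
      rw [mon_mul]
      simp [add_comm]
    rw [this, ← mul_assoc, ih hsum, zero_mul]

include hx hy in
theorem mon_mem_row (p : (Fin n → ℕ) × (Fin r → ℕ)) :
    mon x y p ∈ row 𝒜 (∑ j, p.2 j) :=
  (le_iSup (fun u : ℕ => 𝒜 (u, ∑ j, p.2 j)) _) (mon_mem hx hy p)

include hx hy hgen

theorem row_le_of_forall_mon {v : ℕ} {N : Submodule k R}
    (h : ∀ a b, ∑ j, b j = v → mon x y (a, b) ∈ N) : row 𝒜 v ≤ N := by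
  refine iSup_le fun u => ?_
  rw [piece_eq_span_mon hx hy hgen, Submodule.span_le]
  rintro _ ⟨⟨a, b⟩, hab, rfl⟩
  exact h a b (congrArg Prod.snd hab)

theorem mul_eq_zero_of_mem_row {c : R} {m v : ℕ} (hmv : m ≤ v)
    (hc : ∀ b : Fin r → ℕ, ∑ j, b j = m → c * mon x y (0, b) = 0) {a : R}
    (ha : a ∈ row 𝒜 v) : c * a = 0 := by
  suffices row 𝒜 v ≤ LinearMap.ker (LinearMap.mulLeft k c) from this ha
  refine row_le_of_forall_mon hx hy hgen fun a b hb => ?_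
  rw [LinearMap.mem_ker, LinearMap.mulLeft_apply]
  have hab : mon x y (a, b) = mon x y (0, b) * mon x y (a, 0) := by
    rw [mon_mul]
    simp
  rw [hab, ← mul_assoc, mul_mon_eq_zero hc (t := v - m) (by omega), zero_mul]

/-- The `y^b` with `|b| = v` generate `R_v` over `R_0`. This exhibits the annihilator as a finite
intersection of kernels of the maps `mulMon`. -/
theorem mem_annihilator_rowModule {v : ℕ} {c : rowZero 𝒜} :
    c ∈ Module.annihilator (rowZero 𝒜) (rowModule 𝒜 v) ↔
      ∀ b : Fin r → ℕ, ∑ j, b j = v → (c : R) * mon x y (0, b) = 0 := by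
  rw [Module.mem_annihilator]
  constructor
  · rintro h b rfl
    exact congrArg Subtype.val (h ⟨mon x y (0, b), mon_mem_row hx hy (0, b)⟩)
  · rintro h ⟨a, ha⟩
    exact Subtype.ext (mul_eq_zero_of_mem_row hx hy hgen le_rfl h ha)

theorem finite_rowModule (v : ℕ) : Module.Finite (rowZero 𝒜) (rowModule 𝒜 v) := by
  rw [Module.Finite.iff_fg, Submodule.fg_def]
  refine ⟨(fun b => mon x y (0, b)) '' (Finset.univ.piAntidiag v : Finset (Fin r → ℕ)),
    (Finset.finite_toSet _).image _, le_antisymm (Submodule.span_le.2 ?_) ?_⟩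
  · rintro _ ⟨b, hb, rfl⟩
    rw [Finset.mem_coe, mem_piAntidiag_univ] at hb
    have := mon_mem_row hx hy (0, b)
    rwa [hb] at this
  · intro a ha
    suffices row 𝒜 v ≤ (Submodule.span (rowZero 𝒜) ((fun b => mon x y (0, b)) ''
      (Finset.univ.piAntidiag v : Finset (Fin r → ℕ)))).restrictScalars k from this ha
    refine row_le_of_forall_mon hx hy hgen fun a b hb => ?_
    rw [← mulMon_monZero hx]
    exact Submodule.smul_mem _ (monZero hx a) (Submodule.subset_span
      ⟨b, Finset.mem_coe.2 (mem_piAntidiag_univ.2 hb), rfl⟩)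

theorem rowBelow_le (v u : ℕ) : rowBelow 𝒜 v u ≤
    Finset.univ.sup fun b : (Finset.univ.piAntidiag v : Finset (Fin r → ℕ)) =>
      (rowZeroLE hx u).map (mulMon 𝒜 x y b) := by
  refine Finset.sup_le fun i hi => ?_
  rw [piece_eq_span_mon hx hy hgen, Submodule.span_le]
  rintro _ ⟨⟨a, b⟩, hab, rfl⟩
  simp only [bideg, Set.mem_ofPred_eq, Prod.mk.injEq] at hab
  rw [Finset.mem_range] at hi
  refine (Finset.le_sup (f := fun b : (Finset.univ.piAntidiag v : Finset (Fin r → ℕ)) =>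
      (rowZeroLE hx u).map (mulMon 𝒜 x y b))
    (Finset.mem_univ ⟨b, mem_piAntidiag_univ.2 hab.2⟩)) ?_
  exact ⟨monZero hx a, monZero_mem_rowZeroLE hx (by omega), mulMon_monZero hx a b⟩

-- The shift accounts for the first degree of `y^b`, at most `dv` when `|b| = v`; the extra `1` is
-- there because `rowBelow` uses a strict bound.
omit hgen in
theorem le_rowBelow (v u : ℕ) :
    (Finset.univ.sup fun b : (Finset.univ.piAntidiag v : Finset (Fin r → ℕ)) =>
      (rowZeroLE hx u).map (mulMon 𝒜 x y b)) ≤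
      rowBelow 𝒜 v (u + (Finset.univ.sup d * v + 1)) := by
  refine Finset.sup_le fun b _ => ?_
  rw [rowZeroLE, Submodule.map_span, Submodule.span_le]
  rintro _ ⟨_, ⟨a, ha, rfl⟩, rfl⟩
  have ha' : ∑ i, a i ≤ u := ha
  have hb : ∑ j, b.1 j = v := mem_piAntidiag_univ.1 b.2
  have hle : ∑ j, b.1 j * d j ≤ Finset.univ.sup d * v := by
    refine le_of_le_of_eq ?_ (congrArg (Finset.univ.sup d * ·) hb)
    rw [mul_comm, Finset.sum_mul]
    exact Finset.sum_le_sum fun j _ => Nat.mul_le_mul_left _ (Finset.le_sup (Finset.mem_univ j))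
  rw [mulMon_monZero]
  have hmem := mon_mem hx hy (a, b.1)
  simp only [bideg, hb] at hmem
  exact (Finset.le_sup (f := fun i => 𝒜 (i, v)) (Finset.mem_range.2 (by omega))) hmem

theorem moduleDim_eq_ringDim (v : ℕ) : moduleDim (rowZero 𝒜) (rowModule 𝒜 v) =
    ringDim (rowZero 𝒜 ⧸ Module.annihilator (rowZero 𝒜) (rowModule 𝒜 v)) := by
  have := finite_rowModule hx hy hgen v
  rw [moduleDim, ringDim, Module.supportDim_eq_ringKrullDim_quotient_annihilator]

/-- The dimension of `R_v` is determined by its Hilbert polynomial. -/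
theorem moduleDim_rowModule {v i₀ : ℕ} {p : Polynomial ℚ}
    (hp : ∀ i, i₀ ≤ i → (hilbertFunction 𝒜 i v : ℚ) = p.eval (i : ℚ)) [Decidable (p = 0)] :
    moduleDim (rowZero 𝒜) (rowModule 𝒜 v) =
      ((if p = 0 then 0 else p.natDegree + 1 : ℕ) : ℕ∞) := by
  have hfin := finite_piece hx hy hgen
  have hft := finiteType_rowZero hx hy hgen
  rw [moduleDim_eq_ringDim hx hy hgen]
  set I := Module.annihilator (rowZero 𝒜) (rowModule 𝒜 v) with hI
  -- The zero quotient is excluded from the growth estimate; there `R_v = 0`, so `p = 0` and the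
  -- convention gives dimension `0`.
  rcases subsingleton_or_nontrivial (rowZero 𝒜 ⧸ I) with hsub | hnt
  · have hone : (1 : rowZero 𝒜) ∈ I := by
      rw [Ideal.Quotient.subsingleton_iff.1 hsub]
      trivial
    have hzero : ∀ i, hilbertFunction 𝒜 i v = 0 := by
      intro i
      have : 𝒜 (i, v) = ⊥ := by
        refine eq_bot_iff.2 fun a ha => ?_
        have h1 := (Module.mem_annihilator.1 hone)
          ⟨a, (le_iSup (fun u : ℕ => 𝒜 (u, v)) i) ha⟩
        rw [one_smul] at h1
        exact congrArg Subtype.val h1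
      rw [hilbertFunction, this, finrank_bot]
    have hp0 : p = 0 := by
      refine Polynomial.eq_of_infinite_eval_eq _ _ (Set.Infinite.mono ?_
        ((Set.Ici_infinite i₀).image (Nat.cast_injective (R := ℚ)).injOn))
      rintro _ ⟨i, hi, rfl⟩
      simpa [hzero i] using (hp i hi).symm
    rw [if_pos hp0, ringDim, ringKrullDim_eq_bot_of_subsingleton]
    simp
  · set π : rowZero 𝒜 →ₐ[k] rowZero 𝒜 ⧸ I := Ideal.Quotient.mkₐ k I with hπ
    have hker : LinearMap.ker π.toLinearMap =
        ⨅ b : (Finset.univ.piAntidiag v : Finset (Fin r → ℕ)),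
          LinearMap.ker (mulMon 𝒜 x y b) := by
      ext c
      have h1 : c ∈ LinearMap.ker π.toLinearMap ↔ c ∈ I := Ideal.Quotient.eq_zero_iff_mem
      rw [h1, hI, mem_annihilator_rowModule hx hy hgen]
      simp only [Submodule.mem_iInf, LinearMap.mem_ker, mulMon_apply, Subtype.forall,
        mem_piAntidiag_univ]
    obtain ⟨s, N, c, c', hs, hlow, hupp⟩ := exists_growth_bounds (k := k) (A := rowZero 𝒜 ⧸ I)
      (fun u => (rowZeroLE hx u).map π.toLinearMap)
      (fun u v huv => Submodule.map_mono (rowZeroLE_mono hx huv))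
      ⟨1, one_mem_rowZeroLE hx, map_one π⟩
      (fun u v => by
        rw [← Submodule.map_mul]
        exact Submodule.map_mono (rowZeroLE_mul_le hx u v))
      (fun u => by
        rw [← Submodule.map_mul]
        exact Submodule.map_mono (rowZeroLE_succ_le hx u))
      (fun a => by
        obtain ⟨c, rfl⟩ := Ideal.Quotient.mk_surjective a
        obtain ⟨u, hu⟩ := exists_mem_rowZeroLE hx hy hgen c
        exact ⟨u, c, hu, rfl⟩)
    have hgrow := degree_of_sum_growth (h := fun i => hilbertFunction 𝒜 i v) hp
      (s := s) (N := Fintype.card (Finset.univ.piAntidiag v : Finset (Fin r → ℕ)))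
      (c := c) (c' := Finset.univ.sup d * v + 1)
      (N₂ := Fintype.card (Finset.univ.piAntidiag v : Finset (Fin r → ℕ)) * N)
      (c₂ := c) (c₂' := c')
      (fun u => by
        refine (hlow u).trans ((finrank_map_le_mul_sup hker _).trans ?_)
        refine Nat.mul_le_mul_left _ ?_
        rw [← finrank_rowBelow]
        have : Module.Finite k (rowBelow 𝒜 v (c * u + (Finset.univ.sup d * v + 1))) :=
          finite_finset_sup _ _
        exact Submodule.finrank_mono (le_rowBelow hx hy v (c * u)))
      (fun u => by
        have := finite_finset_sup Finset.univ
          fun b : (Finset.univ.piAntidiag v : Finset (Fin r → ℕ)) =>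
            (rowZeroLE hx u).map (mulMon 𝒜 x y b)
        rw [← finrank_rowBelow, mul_assoc]
        exact (Submodule.finrank_mono (rowBelow_le hx hy hgen v u)).trans
          ((finrank_sup_map_le hker _).trans (Nat.mul_le_mul_left _ (hupp u))))
    rw [ringDim, hs]
    have : s = if p = 0 then 0 else p.natDegree + 1 := by
      split_ifs at hgrow ⊢ <;> exact hgrow
    rw [← this]
    rfl

end RowModule

/-! ### Comparison of `dim R_v` with `x`-dim `R`. -/

section XDim

variable {k R : Type*} [Field k] [CommRing R] [Algebra k R]
  {𝒜 : ℕ × ℕ → Submodule k R}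

theorem row_quotGrading (J : Ideal R) (v : ℕ) :
    row (quotGrading 𝒜 J) v = (row 𝒜 v).map (Ideal.Quotient.mkₐ k J).toLinearMap := by
  rw [row, row, Submodule.map_iSup]
  rfl

/-- `R_0` maps onto the degree-zero row of `R ⧸ J` with kernel `J ∩ R_0`; both dimensions in the
final comparison thus concern quotients of `R_0`. -/
theorem ringDim_rowZero_quotGrading [SetLike.GradedMonoid 𝒜] (J : Ideal R) :
    ringDim (rowZero (quotGrading 𝒜 J)) =
      ringDim (rowZero 𝒜 ⧸ J.comap (algebraMap (rowZero 𝒜) R)) := by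
  have hmem : ∀ c : rowZero 𝒜, Ideal.Quotient.mk J (c : R) ∈ rowZero (quotGrading 𝒜 J) := by
    intro c
    change _ ∈ row (quotGrading 𝒜 J) 0
    rw [row_quotGrading]
    exact ⟨c, c.2, rfl⟩
  let ρ : rowZero 𝒜 →+* rowZero (quotGrading 𝒜 J) :=
    ((Ideal.Quotient.mk J).comp (algebraMap (rowZero 𝒜) R)).codRestrict
      (rowZero (quotGrading 𝒜 J)) hmem
  have hρ : Function.Surjective ρ := by
    rintro ⟨a, ha⟩
    change a ∈ row (quotGrading 𝒜 J) 0 at ha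
    rw [row_quotGrading] at ha
    obtain ⟨c, hc, rfl⟩ := ha
    exact ⟨⟨c, hc⟩, rfl⟩
  have hker : RingHom.ker ρ = J.comap (algebraMap (rowZero 𝒜) R) := by
    ext c
    rw [RingHom.mem_ker, Ideal.mem_comap, ← Ideal.Quotient.eq_zero_iff_mem]
    exact Subtype.ext_iff
  rw [ringDim, ringDim, ← hker,
    ringKrullDim_eq_of_ringEquiv (RingHom.quotientKerEquivOfSurjective hρ)]

variable [GradedAlgebra 𝒜] {n r : ℕ} {x : Fin n → R} {y : Fin r → R} {d : Fin r → ℕ}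
  (hx : ∀ i, x i ∈ 𝒜 (1, 0)) (hy : ∀ j, y j ∈ 𝒜 (d j, 1))
  (hgen : Algebra.adjoin k (Set.range x ∪ Set.range y) = ⊤)

-- `R_{++}` lies in the ideal of the `y_j`, whose `v`-th power lies in the ideal generated by `R_v`.
include hy in
theorem mul_eq_zero_of_mem_irrelevantIdeal_pow {c : R} {v : ℕ}
    (hc : ∀ a ∈ row 𝒜 v, c * a = 0) {b : R} (hb : b ∈ irrelevantIdeal x y ^ v) :
    b * c = 0 := by
  have hle : irrelevantIdeal x y ≤ Ideal.span (Set.range y) := by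
    refine Ideal.span_le.2 ?_
    rintro _ ⟨p, rfl⟩
    exact Ideal.mul_mem_left _ _ (Ideal.subset_span (Set.mem_range_self _))
  have hrow : ∀ m : ℕ, Ideal.span (Set.range y) ^ m ≤ Ideal.span (row 𝒜 m : Set R) := by
    intro m
    induction m with
    | zero =>
      rw [Ideal.eq_top_of_unit_mem (Ideal.span (row 𝒜 0 : Set R)) 1 1
        (Ideal.subset_span (one_mem_row 𝒜)) (one_mul 1)]
      exact le_top
    | succ m ih =>
      rw [pow_succ]
      refine (Ideal.mul_mono_left ih).trans ?_
      rw [Ideal.span_mul_span, Ideal.span_le]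
      rintro _ ⟨a, ha, _, ⟨j, rfl⟩, rfl⟩
      exact Ideal.subset_span
        (mul_mem_row 𝒜 ha ((le_iSup (fun u : ℕ => 𝒜 (u, 1)) (d j)) (hy j)))
  have hann : Ideal.span (row 𝒜 v : Set R) ≤ colonElem ⊥ c :=
    Ideal.span_le.2 fun a ha => mem_colonElem.2 (hc a ha)
  rw [mul_comm]
  exact hann (hrow v (Ideal.pow_right_mono hle v hb))

theorem mul_mem_irrelevantIdeal (i : Fin n) (j : Fin r) : x i * y j ∈ irrelevantIdeal x y :=
  Ideal.subset_span (Set.mem_range_self (i, j))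

include hx hy hgen

/-- For `v` large, the dimension of `R_v` is `x`-dim `R`. -/
theorem eventually_xDim_eq_moduleDim :
    ∀ᶠ v in atTop, xDim 𝒜 x y = moduleDim (rowZero 𝒜) (rowModule 𝒜 v) := by
  have := isNoetherianRing_of_adjoin_eq_top hgen
  obtain ⟨m, hm⟩ := exists_pow_annihilates_zeroColonInfty (irrelevantIdeal x y)
  filter_upwards [eventually_ge_atTop m] with v hv
  rw [xDim, ringDim_rowZero_quotGrading, moduleDim_eq_ringDim hx hy hgen]
  refine (ringDim_quotient_eq (X := Set.range (xZero hx)) ?_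
    (not_lt_of_forall_xZero_mem hx hy hgen) ?_).symm
  · intro c hc
    refine ⟨v, fun b hb => mul_eq_zero_of_mem_irrelevantIdeal_pow hy (fun a ha => ?_) hb⟩
    exact congrArg Subtype.val (Module.mem_annihilator.1 hc ⟨a, ha⟩)
  · rintro _ ⟨i, rfl⟩ c hc
    refine ⟨m, (mem_annihilator_rowModule hx hy hgen).2 fun b hb => ?_⟩
    have hc' : (c : R) ∈ zeroColonInfty (irrelevantIdeal x y) := hc
    refine mul_eq_zero_of_mem_row hx hy hgen hv (fun b' hb' => ?_)
      (by have := mon_mem_row hx hy (0, b); rwa [hb] at this)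
    -- Because `|b'| = m`, each factor `y_j` can be paired with one factor `x_i`. Thus `x_i^m c`
    -- kills all `y^{b'}` of degree `m`, hence all of `R_v` for `v ≥ m`.
    have hmem : x i ^ m * mon x y (0, b') ∈ irrelevantIdeal x y ^ m := by
      have : x i ^ m * mon x y (0, b') = ∏ j, (x i * y j) ^ b' j := by
        simp only [mul_pow, Finset.prod_mul_distrib, Finset.prod_pow_eq_pow_sum, hb']
        simp [mon]
      rw [this, ← hb', ← Finset.prod_pow_eq_pow_sum]
      exact Ideal.prod_mem_prod fun j _ =>
        Ideal.pow_mem_pow (mul_mem_irrelevantIdeal i j) _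
    have := hm _ hc' _ hmem
    rw [← this]
    simp [xZero]
    ring

end XDim

end BigradedHilbert

/-- `R` is a bigraded `k`-algebra generated by elements `x_i` of bidegree `(1,0)` and `y_j` of
bidegree `(d_j,1)`. It has a unique Hilbert polynomial `P`, and
`deg_u P = dim R_v - 1 = x-dim R - 1` for `v` large (all these dimensions are finite). -/
theorem theorem2p3 {k R : Type*} [Field k] [CommRing R] [Algebra k R]
    (𝒜 : ℕ × ℕ → Submodule k R) [GradedAlgebra 𝒜]
    (n r : ℕ) (x : Fin n → R) (y : Fin r → R) (d : Fin r → ℕ)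
    (hx : ∀ i, x i ∈ 𝒜 (1, 0)) (hy : ∀ j, y j ∈ 𝒜 (d j, 1))
    (hgen : Algebra.adjoin k (Set.range x ∪ Set.range y) = ⊤) :
    ∃ P : MvPolynomial (Fin 2) ℚ,
      (∀ Q : MvPolynomial (Fin 2) ℚ,
        BigradedHilbert.IsHilbertPolynomial 𝒜 (Finset.univ.sup d) Q ↔ Q = P) ∧
      ∃ δ : ℕ,
        BigradedHilbert.xDim 𝒜 x y = (δ : ℕ∞) ∧
        BigradedHilbert.degU P = (δ : ℤ) - 1 ∧
        ∃ v₁ : ℕ, ∀ v : ℕ, v₁ ≤ v →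
          BigradedHilbert.moduleDim (BigradedHilbert.rowZero 𝒜)
            (BigradedHilbert.rowModule 𝒜 v) = (δ : ℕ∞) := by
  classical
  obtain ⟨P, u₀, v₀, hP⟩ := BigradedHilbert.exists_hilbertPolynomial hx hy hgen
  refine ⟨P, fun Q => ⟨?_, fun h => h ▸ ⟨u₀, v₀, hP⟩⟩,
    -- The value `0` for `P = 0` matches both conventions, degree `-1` and dimension `0`.
    if P = 0 then 0 else MvPolynomial.degreeOf 0 P + 1, ?_⟩
  · rintro ⟨u₁, v₁, hQ⟩
    refine BigradedHilbert.eq_of_eval_eq_on_region (d := Finset.univ.sup d) (u₀ := u₀ + u₁)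
      (v₀ := v₀ + v₁) fun u v hu hv => ?_
    rw [← hP u v (by omega) (by omega), ← hQ u v (by omega) (by omega)]
  have hdim : ∀ᶠ v in Filter.atTop, BigradedHilbert.moduleDim (BigradedHilbert.rowZero 𝒜)
      (BigradedHilbert.rowModule 𝒜 v) =
        ((if P = 0 then 0 else MvPolynomial.degreeOf 0 P + 1 : ℕ) : ℕ∞) := by
    have hslice : ∀ᶠ v : ℕ in Filter.atTop,
        (if BigradedHilbert.slice P v = 0 then 0
          else (BigradedHilbert.slice P v).natDegree + 1) =
        if P = 0 then 0 else MvPolynomial.degreeOf 0 P + 1 := by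
      by_cases hP0 : P = 0
      · refine Filter.Eventually.of_forall fun v => ?_
        simp [hP0, BigradedHilbert.slice]
      · filter_upwards [BigradedHilbert.eventually_natDegree_slice hP0] with v hv
        rw [if_neg hv.1, if_neg hP0, hv.2]
    filter_upwards [hslice, Filter.eventually_ge_atTop v₀] with v hv hv₀
    rw [← hv]
    refine BigradedHilbert.moduleDim_rowModule hx hy hgen
      (i₀ := Finset.univ.sup d * v + u₀) fun i hi => ?_
    rw [BigradedHilbert.eval_slice, hP i v hi hv₀]
  refine ⟨?_, ?_, Filter.eventually_atTop.1 hdim⟩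
  -- `x`-dim `R` does not depend on `v`, so one sufficiently large `v` determines it.
  · obtain ⟨v, h1, h2⟩ :=
      ((BigradedHilbert.eventually_xDim_eq_moduleDim hx hy hgen).and hdim).exists
    rw [h1, h2]
  · rw [BigradedHilbert.degU]
    split_ifs <;> simp
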